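/- **Theorem.** Over $\mathsf{RCA}_0$, the following are equivalent. (i) $\mathsf{ACA}_0$. (ii) If $Q$ is a wqo, then $\mathcal{P}_\mathrm{f}^\flat(Q)$ is a wqo. That is, $\mathsf{ACA}_0$ proves (ii), and $\mathsf{RCA}_0$ together with (ii) proves every axiom of $\mathsf{ACA}_0$. Here "$T$ proves $\varphi$" is taken as logical consequence: $\varphi$ is true in every structure (with number variables ranging over a set $M$ equipped with $0,1,+,\cdot,<$, and set variables ranging over a given family of subsets of $M$) in which every sentence of $T$ is true; by the completeness theorem this is the same as formal provability. $\mathsf{RCA}_0$ and $\mathsf{ACA}_0$ are theories in the two-sorted language of second-order arithmetic. Both contain the axioms of (the nonnegative part of) a discretely ordered commutative semiring with identity. $\mathsf{RCA}_0$ adds the universal closures of induction for all $\Sigma^0_1$ formulas and of $\Delta^0_1$ comprehension; $\mathsf{ACA}_0$ adds the induction axiom for sets and the universal closures of comprehension for all arithmetical formulas. Statement (ii) is the following sentence of this language. A quasi-order is a pair of sets $(Q,\leq_Q)$ with $\leq_Q\subseteq Q\times Q$ reflexive on $Q$ and transitive, where pairs are coded by $(i,j)=(i+j)^2+i$. It is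 a *well-quasi-order* (wqo) if for every function $f\colon\mathbb{N}\to Q$ (given by a set of pairs) there are $m<n$ with $f(m)\leq_Q f(n)$. The triple $(k,(a,b))$ codes the finite set of all $i<k$ such that $a(i+1)+1$ divides $b$, and the code of a finite set is the least triple that codes it. $\mathcal{P}_\mathrm{f}(Q)$ is the set of codes of finite subsets of $Q$, and $\mathcal{P}_\mathrm{f}^\flat(Q)$ is $\mathcal{P}_\mathrm{f}(Q)$ with the relation $$\mathbf{a}\leq_Q^\flat\mathbf{b}\iff(\forall x\in\mathbf{a})(\exists y\in\mathbf{b})(x\leq_Q y).$$ Sentence (ii) says: for all sets $Q$ and $\leq_Q$ such that $(Q,\leq_Q)$ is a wqo, the sets $\mathcal{P}_\mathrm{f}(Q)$ and $\leq_Q^\flat$ exist and form a wqo. -/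

import Mathlib

universe u

namespace SOA

/-! ## Syntax of second-order arithmetic

The language is two-sorted. Variables are well-scoped de Bruijn indices: in `Formula n m` there are
`n` free number variables and `m` free set variables, and index `0` is always the variable of that
sort that was bound last. -/

/-- Number terms in `n` free number variables. -/
inductive Term : ℕ → Type
  | var {n : ℕ} (i : Fin n) : Term n
  | zero {n : ℕ} : Term n
  | one {n : ℕ} : Term n
  | add {n : ℕ} (s t : Term n) : Term n
  | mul {n : ℕ} (s t : Term n) : Term n

namespace Term

instance {n : ℕ} : Zero (Term n) := ⟨Term.zero⟩
instance {n : ℕ} : One (Term n) := ⟨Term.one⟩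
instance {n : ℕ} : Add (Term n) := ⟨Term.add⟩
instance {n : ℕ} : Mul (Term n) := ⟨Term.mul⟩

/-- Simultaneous substitution of terms for the variables. -/
def subst {n k : ℕ} (σ : Fin n → Term k) : Term n → Term k
  | var i => σ i
  | zero => zero
  | one => one
  | add s t => add (subst σ s) (subst σ t)
  | mul s t => mul (subst σ s) (subst σ t)

/-- The same term, read under one more number quantifier. -/
def up {n : ℕ} (t : Term n) : Term (n + 1) := t.subst fun i => var i.succ

/-- The pairing term `(s + t)² + s`. -/
def pair {n : ℕ} (s t : Term n) : Term n := (s + t) * (s + t) + s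

end Term

/-- Formulas with `n` free number variables and `m` free set variables. Equality is a primitive for
numbers only. -/
inductive Formula : ℕ → ℕ → Type
  | eq {n m : ℕ} (s t : Term n) : Formula n m
  | lt {n m : ℕ} (s t : Term n) : Formula n m
  | mem {n m : ℕ} (t : Term n) (X : Fin m) : Formula n m
  | neg {n m : ℕ} (φ : Formula n m) : Formula n m
  | and {n m : ℕ} (φ ψ : Formula n m) : Formula n m
  | or {n m : ℕ} (φ ψ : Formula n m) : Formula n m
  | imp {n m : ℕ} (φ ψ : Formula n m) : Formula n m
  /-- universal number quantifier -/
  | all {n m : ℕ} (φ : Formula (n + 1) m) : Formula n m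
  /-- existential number quantifier -/
  | ex {n m : ℕ} (φ : Formula (n + 1) m) : Formula n m
  /-- universal set quantifier -/
  | allSet {n m : ℕ} (φ : Formula n (m + 1)) : Formula n m
  /-- existential set quantifier -/
  | exSet {n m : ℕ} (φ : Formula n (m + 1)) : Formula n m

infix:50 " ≐ " => Formula.eq
infix:50 " ≺' " => Formula.lt
infix:50 " ∈' " => Formula.mem
infixr:35 " ∧' " => Formula.and
infixr:30 " ∨' " => Formula.or
infixr:25 " →' " => Formula.imp

/-- A sentence is a formula without free variables. -/
abbrev Sentence : Type := Formula 0 0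

/-- A theory is a set of sentences. -/
abbrev Theory : Type := Set Sentence

namespace Formula

/-- The biconditional. -/
def iff {n m : ℕ} (φ ψ : Formula n m) : Formula n m := (φ →' ψ) ∧' (ψ →' φ)

/-- Capture-avoiding simultaneous substitution of terms for the free number variables and of set
variables for the free set variables. -/
def subst : {n m k l : ℕ} → (Fin n → Term k) → (Fin m → Fin l) → Formula n m → Formula k l
  | _, _, _, _, σ, _, eq s t => eq (s.subst σ) (t.subst σ)
  | _, _, _, _, σ, _, lt s t => lt (s.subst σ) (t.subst σ)
  | _, _, _, _, σ, ρ, mem t X => mem (t.subst σ) (ρ X)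
  | _, _, _, _, σ, ρ, neg φ => neg (subst σ ρ φ)
  | _, _, _, _, σ, ρ, and φ ψ => and (subst σ ρ φ) (subst σ ρ ψ)
  | _, _, _, _, σ, ρ, or φ ψ => or (subst σ ρ φ) (subst σ ρ ψ)
  | _, _, _, _, σ, ρ, imp φ ψ => imp (subst σ ρ φ) (subst σ ρ ψ)
  | _, _, _, _, σ, ρ, all φ => all (subst (Fin.cons (Term.var 0) fun i => (σ i).up) ρ φ)
  | _, _, _, _, σ, ρ, ex φ => ex (subst (Fin.cons (Term.var 0) fun i => (σ i).up) ρ φ)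
  | _, _, _, _, σ, ρ, allSet φ => allSet (subst σ (Fin.cons 0 fun i => (ρ i).succ) φ)
  | _, _, _, _, σ, ρ, exSet φ => exSet (subst σ (Fin.cons 0 fun i => (ρ i).succ) φ)

/-- `φ(0)`, where `φ(x)` has `x` as its number variable `0`. -/
def atZero {n m : ℕ} (φ : Formula (n + 1) m) : Formula n m :=
  φ.subst (Fin.cons 0 Term.var) id

/-- `φ(x + 1)`, where `φ(x)` has `x` as its number variable `0`. -/
def atSucc {n m : ℕ} (φ : Formula (n + 1) m) : Formula (n + 1) m :=
  φ.subst (Fin.cons (Term.var 0 + 1) fun i => Term.var i.succ) id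

/-- The same formula, read under one more set quantifier; the new set variable `0` is not free
in the result. -/
def upSet {n m : ℕ} (φ : Formula n m) : Formula n (m + 1) :=
  φ.subst Term.var Fin.succ

/-- Universal closure with respect to the free number variables. -/
def closeNum : {n m : ℕ} → Formula n m → Formula 0 m
  | 0, _, φ => φ
  | _ + 1, _, φ => closeNum (all φ)

/-- Universal closure with respect to the free set variables. -/
def closeSet : {m : ℕ} → Formula 0 m → Sentence
  | 0, φ => φ
  | _ + 1, φ => closeSet (allSet φ)

/-- Universal closure with respect to all free variables. -/
def closure {n m : ℕ} (φ : Formula n m) : Sentence := φ.closeNum.closeSet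

/-- The bounded quantifier `∀ x < t, φ(x)`; the bound `t` does not contain `x`. -/
def allLT {n m : ℕ} (t : Term n) (φ : Formula (n + 1) m) : Formula n m :=
  all (Term.var 0 ≺' t.up →' φ)

/-- The bounded quantifier `∃ x < t, φ(x)`; the bound `t` does not contain `x`. -/
def exLT {n m : ℕ} (t : Term n) (φ : Formula (n + 1) m) : Formula n m :=
  ex (Term.var 0 ≺' t.up ∧' φ)

/-- Bounded-quantifier formulas: all quantifiers are bounded number quantifiers. Free set variables
are allowed. -/
inductive IsBounded : {n m : ℕ} → Formula n m → Prop
  | eq {n m : ℕ} (s t : Term n) : IsBounded (eq s t : Formula n m)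
  | lt {n m : ℕ} (s t : Term n) : IsBounded (lt s t : Formula n m)
  | mem {n m : ℕ} (t : Term n) (X : Fin m) : IsBounded (mem t X)
  | neg {n m : ℕ} {φ : Formula n m} : IsBounded φ → IsBounded (neg φ)
  | and {n m : ℕ} {φ ψ : Formula n m} : IsBounded φ → IsBounded ψ → IsBounded (and φ ψ)
  | or {n m : ℕ} {φ ψ : Formula n m} : IsBounded φ → IsBounded ψ → IsBounded (or φ ψ)
  | imp {n m : ℕ} {φ ψ : Formula n m} : IsBounded φ → IsBounded ψ → IsBounded (imp φ ψ)
  | allLT {n m : ℕ} (t : Term n) {φ : Formula (n + 1) m} : IsBounded φ → IsBounded (allLT t φ)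
  | exLT {n m : ℕ} (t : Term n) {φ : Formula (n + 1) m} : IsBounded φ → IsBounded (exLT t φ)

/-- `Σ⁰₁` formulas: `∃ x θ` with `θ` a bounded-quantifier formula. -/
def IsSigma01 {n m : ℕ} (φ : Formula n m) : Prop :=
  ∃ θ : Formula (n + 1) m, θ.IsBounded ∧ φ = ex θ

/-- `Π⁰₁` formulas: `∀ x θ` with `θ` a bounded-quantifier formula. -/
def IsPi01 {n m : ℕ} (φ : Formula n m) : Prop :=
  ∃ θ : Formula (n + 1) m, θ.IsBounded ∧ φ = all θ

/-- Arithmetical formulas: no set quantifiers. Free set variables are allowed. -/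
def IsArithmetical : {n m : ℕ} → Formula n m → Prop
  | _, _, eq _ _ => True
  | _, _, lt _ _ => True
  | _, _, mem _ _ => True
  | _, _, neg φ => IsArithmetical φ
  | _, _, and φ ψ => IsArithmetical φ ∧ IsArithmetical ψ
  | _, _, or φ ψ => IsArithmetical φ ∧ IsArithmetical ψ
  | _, _, imp φ ψ => IsArithmetical φ ∧ IsArithmetical ψ
  | _, _, all φ => IsArithmetical φ
  | _, _, ex φ => IsArithmetical φ
  | _, _, allSet _ => False
  | _, _, exSet _ => False

end Formula

/-! ## Semantics -/

/-- A structure for the language of second-order arithmetic: number variables range over `carrier`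
and set variables range over the family `sets` of subsets of `carrier`. -/
structure Model : Type (u + 1) where
  carrier : Type u
  sets : Set (Set carrier)
  zero : carrier
  one : carrier
  add : carrier → carrier → carrier
  mul : carrier → carrier → carrier
  lt : carrier → carrier → Prop

/-- The value of a term under an assignment. -/
def Term.val (M : Model.{u}) {n : ℕ} (v : Fin n → M.carrier) : Term n → M.carrier
  | .var i => v i
  | .zero => M.zero
  | .one => M.one
  | .add s t => M.add (s.val M v) (t.val M v)
  | .mul s t => M.mul (s.val M v) (t.val M v)

/-- Satisfaction of a formula under assignments to its number and set variables. -/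
def Formula.Sat (M : Model.{u}) :
    {n m : ℕ} → (Fin n → M.carrier) → (Fin m → Set M.carrier) → Formula n m → Prop
  | _, _, v, _, .eq s t => s.val M v = t.val M v
  | _, _, v, _, .lt s t => M.lt (s.val M v) (t.val M v)
  | _, _, v, V, .mem t X => t.val M v ∈ V X
  | _, _, v, V, .neg φ => ¬ Sat M v V φ
  | _, _, v, V, .and φ ψ => Sat M v V φ ∧ Sat M v V ψ
  | _, _, v, V, .or φ ψ => Sat M v V φ ∨ Sat M v V ψ
  | _, _, v, V, .imp φ ψ => Sat M v V φ → Sat M v V ψ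
  | _, _, v, V, .all φ => ∀ a : M.carrier, Sat M (Fin.cons a v) V φ
  | _, _, v, V, .ex φ => ∃ a : M.carrier, Sat M (Fin.cons a v) V φ
  | _, _, v, V, .allSet φ => ∀ A ∈ M.sets, Sat M v (Fin.cons A V) φ
  | _, _, v, V, .exSet φ => ∃ A ∈ M.sets, Sat M v (Fin.cons A V) φ

/-- Truth of a sentence in a structure. -/
def Model.Satisfies (M : Model.{u}) (φ : Sentence) : Prop :=
  φ.Sat M Fin.elim0 Fin.elim0

/-- Logical consequence: `φ` is true in every structure (with carrier in the universe `u`, which is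
arbitrary) in which all sentences of `T` are true. By soundness and completeness of two-sorted
first-order logic this is provability `T ⊢ φ`. -/
def Theory.Entails (T : Theory) (φ : Sentence) : Prop :=
  ∀ M : Model.{u}, (∀ ψ ∈ T, M.Satisfies ψ) → M.Satisfies φ

/-- A theory `T` and a sentence `φ` are equivalent over the base theory `B`: `T ⊢ φ`, and
`B + φ ⊢ ψ` for every axiom `ψ` of `T`. -/
def EquivalentOver (B T : Theory) (φ : Sentence) : Prop :=
  Theory.Entails.{u} T φ ∧ ∀ ψ ∈ T, Theory.Entails.{u} (B ∪ {φ}) ψ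

/-! ## The theories `RCA₀` and `ACA₀` -/

open Formula Term

/-- The numbers form (the nonnegative part of) a discretely ordered commutative semiring with
identity. -/
def basicAxioms : Theory :=
  { -- addition
    all (all (all ((var 2 + var 1) + var 0 ≐ var 2 + (var 1 + var 0)))),
    all (all (var 1 + var 0 ≐ var 0 + var 1)),
    all (var 0 + 0 ≐ var 0),
    -- multiplication
    all (all (all ((var 2 * var 1) * var 0 ≐ var 2 * (var 1 * var 0)))),
    all (all (var 1 * var 0 ≐ var 0 * var 1)),
    all (var 0 * 1 ≐ var 0),
    all (var 0 * 0 ≐ 0),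
    all (all (all (var 2 * (var 1 + var 0) ≐ var 2 * var 1 + var 2 * var 0))),
    -- strict linear order
    all (neg (var 0 ≺' var 0)),
    all (all (all (var 2 ≺' var 1 ∧' var 1 ≺' var 0 →' var 2 ≺' var 0))),
    all (all (var 1 ≺' var 0 ∨' var 1 ≐ var 0 ∨' var 0 ≺' var 1)),
    -- compatibility of the order with the operations
    all (all (all (var 2 ≺' var 1 →' var 2 + var 0 ≺' var 1 + var 0))),
    all (all (all (0 ≺' var 0 ∧' var 2 ≺' var 1 →' var 2 * var 0 ≺' var 1 * var 0))),
    all (all (var 1 ≺' var 0 →' ex (var 2 + var 0 ≐ var 1))),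
    -- zero is the least element, and one is its immediate successor
    all (0 ≐ var 0 ∨' 0 ≺' var 0),
    0 ≺' 1,
    all (0 ≺' var 0 →' 1 ≐ var 0 ∨' 1 ≺' var 0) }

/-- The induction axiom for `φ(x)`, where `x` is number variable `0` and the other free variables
are parameters. -/
def inductionFor {n m : ℕ} (φ : Formula (n + 1) m) : Sentence :=
  closure (φ.atZero ∧' all (φ →' φ.atSucc) →' all φ)

/-- The comprehension axiom for `φ(x)`: the set of all `x` with `φ(x)` exists. -/
def comprehensionFor {n m : ℕ} (φ : Formula (n + 1) m) : Sentence :=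
  closure (exSet (all (iff (var 0 ∈' 0) φ.upSet)))

/-- The `Δ⁰₁` comprehension axiom for `φ(x)` and `ψ(x)`. -/
def deltaComprehensionFor {n m : ℕ} (φ ψ : Formula (n + 1) m) : Sentence :=
  closure (all (iff φ ψ) →' exSet (all (iff (var 0 ∈' 0) φ.upSet)))

/-- The induction axiom for sets. -/
def setInduction : Sentence :=
  allSet (0 ∈' 0 ∧' all (var 0 ∈' 0 →' var 0 + 1 ∈' 0) →' all (var 0 ∈' 0))

/-- `RCA₀`: basic axioms, `Σ⁰₁` induction and `Δ⁰₁` comprehension. -/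
def RCA₀ : Theory :=
  basicAxioms ∪
  { χ | ∃ (n m : ℕ) (φ : Formula (n + 1) m), φ.IsSigma01 ∧ χ = inductionFor φ } ∪
  { χ | ∃ (n m : ℕ) (φ ψ : Formula (n + 1) m),
      φ.IsSigma01 ∧ ψ.IsPi01 ∧ χ = deltaComprehensionFor φ ψ }

/-- `ACA₀`: basic axioms, the induction axiom and arithmetical comprehension. -/
def ACA₀ : Theory :=
  basicAxioms ∪ {setInduction} ∪
  { χ | ∃ (n m : ℕ) (φ : Formula (n + 1) m), φ.IsArithmetical ∧ χ = comprehensionFor φ }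

/-! ## Well-quasi-orders and finite powersets in second-order arithmetic -/

/-- The set `R` of (codes of) pairs is a quasi-order on the set `Q`. -/
def isQuasiOrder {m : ℕ} (Q R : Fin m) : Formula 0 m :=
  all (var 0 ∈' R →' ex (ex (var 2 ≐ pair (var 1) (var 0) ∧' var 1 ∈' Q ∧' var 0 ∈' Q))) ∧'
  all (var 0 ∈' Q →' pair (var 0) (var 0) ∈' R) ∧'
  all (all (all (pair (var 2) (var 1) ∈' R ∧' pair (var 1) (var 0) ∈' R →'
    pair (var 2) (var 0) ∈' R)))

/-- The set `F` is (the graph of) a function from the numbers to `Q`. -/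
def isSequenceIn {m : ℕ} (F Q : Fin m) : Formula 0 m :=
  all (var 0 ∈' F →' ex (ex (var 2 ≐ pair (var 1) (var 0) ∧' var 0 ∈' Q))) ∧'
  all (ex (pair (var 1) (var 0) ∈' F)) ∧'
  all (all (all (pair (var 2) (var 1) ∈' F ∧' pair (var 2) (var 0) ∈' F →' var 1 ≐ var 0)))

/-- `(Q, R)` is a wqo: it is a quasi-order, and for every function `F` from the numbers to `Q`
there are `i < j` with `F(i) ≤ F(j)`. The number variables `3, 2, 1, 0` are `i, j, F(i), F(j)`. -/
def isWQO {m : ℕ} (Q R : Fin m) : Formula 0 m :=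
  isQuasiOrder Q R ∧'
  allSet (isSequenceIn 0 Q.succ →'
    ex (ex (ex (ex (var 3 ≺' var 2 ∧' pair (var 3) (var 1) ∈' 0 ∧'
      pair (var 2) (var 0) ∈' 0 ∧' pair (var 1) (var 0) ∈' R.succ)))))

/-- `c = (k, (a, b))` for some `k, a, b`. -/
def isTriple {n m : ℕ} (c : Term n) : Formula n m :=
  ex (ex (ex (c.up.up.up ≐ pair (var 2) (pair (var 1) (var 0)))))

/-- `i` belongs to the finite set coded by `c`: `c = (k, (a, b))` with `i < k` such that
`a (i + 1) + 1` divides `b`. -/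
def memCoded {n m : ℕ} (i c : Term n) : Formula n m :=
  ex (ex (ex (c.up.up.up ≐ pair (var 2) (pair (var 1) (var 0)) ∧'
    i.up.up.up ≺' var 2 ∧'
    ex (var 1 ≐ var 0 * (var 2 * (i.up.up.up.up + 1) + 1)))))

/-- `c` is the code of a finite set: the least triple coding that set. -/
def isFiniteSetCode {n m : ℕ} (c : Term n) : Formula n m :=
  isTriple c ∧'
  all (var 0 ≺' c.up ∧' isTriple (var 0) →'
    neg (all (iff (memCoded (var 0) c.up.up) (memCoded (var 0) (var 1)))))

/-- `P` is the set of (codes of) finite subsets of `Q`. -/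
def isFinitePowerset {m : ℕ} (P Q : Fin m) : Formula 0 m :=
  all (iff (var 0 ∈' P)
    (isFiniteSetCode (var 0) ∧' all (memCoded (var 0) (var 1) →' var 0 ∈' Q)))

/-- `L` is the relation `≤^♭` on `P` induced by `R`: it consists of the pairs `(c, d)` of elements
of `P` such that every `x ∈ c` has some `y ∈ d` with `(x, y) ∈ R`. -/
def isFlatOrder {m : ℕ} (L P R : Fin m) : Formula 0 m :=
  all (iff (var 0 ∈' L)
    (ex (ex (var 2 ≐ pair (var 1) (var 0) ∧' var 1 ∈' P ∧' var 0 ∈' P ∧'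
      all (memCoded (var 0) (var 2) →'
        ex (memCoded (var 0) (var 2) ∧' pair (var 1) (var 0) ∈' R))))))

/-- "If `(Q, R)` is a wqo, then the set `P` of finite subsets of `Q` with the relation `L = ≤^♭`
is a wqo." The set variables are `Q = 1`, `R = 0` and then `Q = 3`, `R = 2`, `P = 1`, `L = 0`. -/
def flatWQO : Sentence :=
  allSet (allSet (isWQO 1 0 →'
    exSet (exSet (isFinitePowerset 1 3 ∧' isFlatOrder 0 1 2 ∧' isWQO 1 0))))

end SOA

namespace SOA

/-! ## Substitution and closure -/

/-! Entailment is semantic, so both directions are arguments inside one arbitrary, possibly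
nonstandard, model `M`. Definability is tracked by `D0`: relations given by bounded formulas with
number and set parameters. Finite sets are handled by Gödel's β-function: `exists_code_sigma` is
bounded Σ⁰₁ comprehension, and `exists_bound` follows from it.

From `ACA₀` to the powerset statement: let `f` be a sequence of finite subsets of `Q` with `f m ≤^♭
f n` for no `m < n`. Colour `(m, n)` with the least `x ∈ f m` that lies below no element of `f n`.
For fixed `m` the colours are bounded by the code `f m`, so an arithmetical tree argument
(`exists_endHomogeneous`) gives indices `h 0 < h 1 < ...` such that the colour of `(h i, h j)` is
some `x i` depending on `i` only. Since `x j ∈ f (h j)`, the element `x i` is not below `x j` for `i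
< j`, and `Q` is not a wqo.

From the powerset statement to `ACA₀`: Σ⁰₁ comprehension suffices, because a Σ⁰₁ set that exists can
serve as a set parameter, which absorbs unbounded quantifiers one at a time
(`D0.of_isArithmetical`). Let `K` be Σ⁰₁, with increasing stages `T_s`. A guess `(v, s)` claims that
`K` and `T_s` agree below `v`; it lies below itself and below the guesses `(w, t)` with `t > s`
whose stage refutes it, that is, `T_s` and `T_t` differ below `v`. Let `F n` be the finite set of
guesses current at stage `n`, for all `v ≤ n`. For `m < n`, some guess in `F m` is neither refuted
by stage `n` nor still current there (`current_bad`), so `F` is a bad sequence for `≤^♭`. The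
powerset statement then yields a bad sequence of guesses `(v_i, s_i)`. It has no repetitions, so its
stages are unbounded; as no guess in it is refuted by a later one, all of them are correct. The
`v_i` are unbounded too, since only boundedly many guesses have `v` below a given bound. Hence `x ∈
K` can be read off at any `i` with `x < v_i`, and `K` exists by Δ⁰₁ comprehension. -/

theorem Term.val_subst (M : Model.{u}) {n k : ℕ} (σ : Fin n → Term k) (t : Term n)
    (v : Fin k → M.carrier) :
    (t.subst σ).val M v = t.val M (fun i => (σ i).val M v) := by
  induction t with
  | var i => rfl
  | zero => rfl
  | one => rfl
  | add s t hs ht => simp only [Term.subst, Term.val, hs, ht]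
  | mul s t hs ht => simp only [Term.subst, Term.val, hs, ht]

theorem Term.val_up (M : Model.{u}) {n : ℕ} (t : Term n) (a : M.carrier) (v : Fin n → M.carrier) :
    t.up.val M (Fin.cons a v : Fin (n + 1) → M.carrier) = t.val M v := by
  rw [Term.up, Term.val_subst]; rfl

theorem cons_comp {α β : Type*} {n : ℕ} (f : α → β) (a : α) (v : Fin n → α) :
    (fun i => f ((Fin.cons a v : Fin (n + 1) → α) i)) = Fin.cons (f a) (fun i => f (v i)) := by
  funext i; refine Fin.cases rfl (fun _ => rfl) i

theorem cons_subst_val (M : Model.{u}) {n k : ℕ} (σ : Fin n → Term k) (a : M.carrier)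
    (v : Fin k → M.carrier) :
    (fun i => Term.val M (Fin.cons a v : Fin (k + 1) → M.carrier)
      ((Fin.cons (Term.var 0) (fun i => (σ i).up) : Fin (n + 1) → Term (k + 1)) i)) =
      Fin.cons a (fun i => (σ i).val M v) := by
  rw [cons_comp]
  congr 1
  funext i
  exact Term.val_up M _ _ _

theorem Formula.sat_subst (M : Model.{u}) {n m : ℕ} (φ : Formula n m) : ∀ {k l : ℕ}
    (σ : Fin n → Term k) (ρ : Fin m → Fin l) (v : Fin k → M.carrier) (V : Fin l → Set M.carrier),
    (φ.subst σ ρ).Sat M v V ↔ φ.Sat M (fun i => (σ i).val M v) (fun i => V (ρ i)) := by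
  induction φ with
  | eq s t => intros; simp only [Formula.subst, Formula.Sat, Term.val_subst]
  | lt s t => intros; simp only [Formula.subst, Formula.Sat, Term.val_subst]
  | mem t X => intros; simp only [Formula.subst, Formula.Sat, Term.val_subst]
  | neg φ h => intros; simp only [Formula.subst, Formula.Sat, h]
  | and φ ψ h h' => intros; simp only [Formula.subst, Formula.Sat, h, h']
  | or φ ψ h h' => intros; simp only [Formula.subst, Formula.Sat, h, h']
  | imp φ ψ h h' => intros; simp only [Formula.subst, Formula.Sat, h, h']
  | all φ h => intros; simp only [Formula.subst, Formula.Sat, h, cons_subst_val]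
  | ex φ h => intros; simp only [Formula.subst, Formula.Sat, h, cons_subst_val]
  | allSet φ h =>
    intros k l σ ρ v V
    simp only [Formula.subst, Formula.Sat, h, cons_comp]
    exact Iff.rfl
  | exSet φ h =>
    intros k l σ ρ v V
    simp only [Formula.subst, Formula.Sat, h]
    refine exists_congr fun A => and_congr_right fun _ => ?_
    rw [cons_comp (Fin.cons A V : Fin (l + 1) → Set M.carrier)]; rfl

theorem Term.subst_up {n k : ℕ} (σ : Fin n → Term k) (t : Term n) :
    t.up.subst (Fin.cons (Term.var 0) fun i => (σ i).up) = (t.subst σ).up := by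
  unfold Term.up
  induction t with
  | var i => rfl
  | zero => rfl
  | one => rfl
  | add s t hs ht => simp only [Term.subst, hs, ht]
  | mul s t hs ht => simp only [Term.subst, hs, ht]

theorem Formula.IsBounded.subst {n m : ℕ} {φ : Formula n m} (h : φ.IsBounded) : ∀ {k l : ℕ}
    (σ : Fin n → Term k) (ρ : Fin m → Fin l), (φ.subst σ ρ).IsBounded := by
  induction h with
  | eq s t => intros; exact .eq _ _
  | lt s t => intros; exact .lt _ _
  | mem s t => intros; exact .mem _ _
  | neg _ h => intros; exact .neg (h _ _)
  | and _ _ h h' => intros; exact .and (h _ _) (h' _ _)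
  | or _ _ h h' => intros; exact .or (h _ _) (h' _ _)
  | imp _ _ h h' => intros; exact .imp (h _ _) (h' _ _)
  | allLT t _ h =>
    intros k l σ ρ
    simp only [Formula.allLT, Formula.subst, Term.subst_up]
    exact .allLT _ (h _ _)
  | exLT t _ h =>
    intros k l σ ρ
    simp only [Formula.exLT, Formula.subst, Term.subst_up]
    exact .exLT _ (h _ _)

theorem Formula.IsBounded.isArithmetical {n m : ℕ} {φ : Formula n m} (h : φ.IsBounded) :
    φ.IsArithmetical := by
  induction h with
  | eq s t => trivial
  | lt s t => trivial
  | mem s t => trivial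
  | neg _ h => exact h
  | and _ _ h h' => exact ⟨h, h'⟩
  | or _ _ h h' => exact ⟨h, h'⟩
  | imp _ _ h h' => exact ⟨h, h'⟩
  | allLT t _ h => exact ⟨trivial, h⟩
  | exLT t _ h => exact ⟨trivial, h⟩

theorem Formula.sat_closeNum (M : Model.{u}) {n m : ℕ} (φ : Formula n m)
    (v₀ : Fin 0 → M.carrier) (V : Fin m → Set M.carrier) :
    φ.closeNum.Sat M v₀ V ↔ ∀ v : Fin n → M.carrier, φ.Sat M v V := by
  induction n with
  | zero =>
    simp only [closeNum]
    exact ⟨fun h v => by rwa [Subsingleton.elim v v₀], fun h => h _⟩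
  | succ n ih =>
    simp only [closeNum, ih, Formula.Sat]
    refine ⟨fun h v => ?_, fun h v a => h _⟩
    rw [← Fin.cons_self_tail v]
    exact h _ _

theorem Formula.sat_closeSet (M : Model.{u}) {m : ℕ} (φ : Formula 0 m) (v₀ : Fin 0 → M.carrier)
    (V₀ : Fin 0 → Set M.carrier) :
    φ.closeSet.Sat M v₀ V₀ ↔
      ∀ V : Fin m → Set M.carrier, (∀ i, V i ∈ M.sets) → φ.Sat M v₀ V := by
  induction m with
  | zero =>
    simp only [closeSet]
    exact ⟨fun h v _ => by rwa [Subsingleton.elim v V₀], fun h => h _ (fun i => i.elim0)⟩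
  | succ n ih =>
    simp only [closeSet, ih, Formula.Sat]
    refine ⟨fun h V hV => ?_, fun h v hv a ha => h _ (Fin.cases ha hv)⟩
    rw [← Fin.cons_self_tail V]
    exact h _ (fun i => hV i.succ) _ (hV 0)

theorem Formula.satisfies_closure (M : Model.{u}) {n m : ℕ} (φ : Formula n m) :
    M.Satisfies φ.closure ↔ ∀ (V : Fin m → Set M.carrier), (∀ i, V i ∈ M.sets) →
      ∀ v : Fin n → M.carrier, φ.Sat M v V := by
  simp only [Model.Satisfies, closure, sat_closeSet, sat_closeNum]

theorem Formula.sat_upSet (M : Model.{u}) {n m : ℕ} (φ : Formula n m) (v : Fin n → M.carrier)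
    (A : Set M.carrier) (V : Fin m → Set M.carrier) :
    φ.upSet.Sat M v (Fin.cons A V : Fin (m + 1) → Set M.carrier) ↔ φ.Sat M v V := by
  rw [upSet, sat_subst]; rfl

theorem Formula.sat_iff (M : Model.{u}) {n m : ℕ} (φ ψ : Formula n m) (v : Fin n → M.carrier)
    (V : Fin m → Set M.carrier) : (φ.iff ψ).Sat M v V ↔ (φ.Sat M v V ↔ ψ.Sat M v V) := by
  simp only [iff, Sat]; exact iff_def.symm

theorem Formula.sat_atZero (M : Model.{u}) {n m : ℕ} (φ : Formula (n + 1) m)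
    (v : Fin n → M.carrier) (V : Fin m → Set M.carrier) :
    φ.atZero.Sat M v V ↔ φ.Sat M (Fin.cons M.zero v : Fin (n + 1) → M.carrier) V := by
  rw [atZero, sat_subst, cons_comp]; rfl

theorem Formula.sat_atSucc (M : Model.{u}) {n m : ℕ} (φ : Formula (n + 1) m) (a : M.carrier)
    (v : Fin n → M.carrier) (V : Fin m → Set M.carrier) :
    φ.atSucc.Sat M (Fin.cons a v : Fin (n + 1) → M.carrier) V ↔
      φ.Sat M (Fin.cons (M.add a M.one) v : Fin (n + 1) → M.carrier) V := by
  rw [atSucc, sat_subst, cons_comp]; rfl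

theorem satisfies_inductionFor (M : Model.{u}) {n m : ℕ} (φ : Formula (n + 1) m) :
    M.Satisfies (inductionFor φ) ↔ ∀ (V : Fin m → Set M.carrier), (∀ i, V i ∈ M.sets) →
      ∀ v : Fin n → M.carrier,
        φ.Sat M (Fin.cons M.zero v : Fin (n + 1) → M.carrier) V ∧
        (∀ a, φ.Sat M (Fin.cons a v : Fin (n + 1) → M.carrier) V →
          φ.Sat M (Fin.cons (M.add a M.one) v : Fin (n + 1) → M.carrier) V) →
        ∀ a, φ.Sat M (Fin.cons a v : Fin (n + 1) → M.carrier) V := by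
  simp only [inductionFor, Formula.satisfies_closure, Formula.Sat, Formula.sat_atZero,
    Formula.sat_atSucc]

theorem satisfies_comprehensionFor (M : Model.{u}) {n m : ℕ} (φ : Formula (n + 1) m) :
    M.Satisfies (comprehensionFor φ) ↔ ∀ (V : Fin m → Set M.carrier), (∀ i, V i ∈ M.sets) →
      ∀ v : Fin n → M.carrier,
        {a | φ.Sat M (Fin.cons a v : Fin (n + 1) → M.carrier) V} ∈ M.sets := by
  simp only [comprehensionFor, Formula.satisfies_closure, Formula.Sat, Formula.sat_iff,
    Formula.sat_upSet]
  refine forall_congr' fun V => forall_congr' fun hV => forall_congr' fun v => ?_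
  constructor
  · rintro ⟨A, hA, h⟩
    convert hA
    ext a
    exact (h a).symm
  · exact fun h => ⟨_, h, fun a => Iff.rfl⟩

theorem satisfies_deltaComprehensionFor (M : Model.{u}) {n m : ℕ} (φ ψ : Formula (n + 1) m) :
    M.Satisfies (deltaComprehensionFor φ ψ) ↔ ∀ (V : Fin m → Set M.carrier),
      (∀ i, V i ∈ M.sets) → ∀ v : Fin n → M.carrier,
        (∀ a, φ.Sat M (Fin.cons a v : Fin (n + 1) → M.carrier) V ↔
          ψ.Sat M (Fin.cons a v : Fin (n + 1) → M.carrier) V) →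
        {a | φ.Sat M (Fin.cons a v : Fin (n + 1) → M.carrier) V} ∈ M.sets := by
  simp only [deltaComprehensionFor, Formula.satisfies_closure, Formula.Sat, Formula.sat_iff,
    Formula.sat_upSet]
  refine forall_congr' fun V => forall_congr' fun hV => forall_congr' fun v =>
    forall_congr' fun _ => ?_
  constructor
  · rintro ⟨A, hA, h⟩
    convert hA
    ext a
    exact (h a).symm
  · exact fun h => ⟨_, h, fun a => Iff.rfl⟩

/-! ## The arithmetic of a model -/

/-- The basic axioms, stated in the metalanguage. -/
class BasicModel (M : Model.{u}) : Prop where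
  add_assoc : ∀ a b c, M.add (M.add a b) c = M.add a (M.add b c)
  add_comm : ∀ a b, M.add a b = M.add b a
  add_zero : ∀ a, M.add a M.zero = a
  mul_assoc : ∀ a b c, M.mul (M.mul a b) c = M.mul a (M.mul b c)
  mul_comm : ∀ a b, M.mul a b = M.mul b a
  mul_one : ∀ a, M.mul a M.one = a
  mul_zero : ∀ a, M.mul a M.zero = M.zero
  mul_add : ∀ a b c, M.mul a (M.add b c) = M.add (M.mul a b) (M.mul a c)
  lt_irrefl : ∀ a, ¬ M.lt a a
  lt_trans : ∀ a b c, M.lt a b ∧ M.lt b c → M.lt a c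
  lt_tri : ∀ a b, M.lt a b ∨ a = b ∨ M.lt b a
  add_lt : ∀ a b c, M.lt a b → M.lt (M.add a c) (M.add b c)
  mul_lt : ∀ a b c, M.lt M.zero c ∧ M.lt a b → M.lt (M.mul a c) (M.mul b c)
  exists_add : ∀ a b, M.lt a b → ∃ c, M.add a c = b
  zero_le : ∀ a, M.zero = a ∨ M.lt M.zero a
  zero_lt_one : M.lt M.zero M.one
  one_le : ∀ a, M.lt M.zero a → M.one = a ∨ M.lt M.one a

theorem basicModel_iff (M : Model.{u}) :
    BasicModel M ↔ ∀ ψ ∈ basicAxioms, M.Satisfies ψ := by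
  constructor
  · intro h
    simp only [basicAxioms, Set.mem_insert_iff, Set.mem_singleton_iff, forall_eq_or_imp, forall_eq]
    exact ⟨h.add_assoc, h.add_comm, h.add_zero, h.mul_assoc, h.mul_comm, h.mul_one, h.mul_zero,
      h.mul_add, h.lt_irrefl, h.lt_trans, h.lt_tri, h.add_lt, h.mul_lt, h.exists_add, h.zero_le,
      h.zero_lt_one, h.one_le⟩
  · intro h
    simp only [basicAxioms, Set.mem_insert_iff, Set.mem_singleton_iff, forall_eq_or_imp, forall_eq]
      at h
    obtain ⟨h1, h2, h3, h4, h5, h6, h7, h8, h9, h10, h11, h12, h13, h14, h15, h16, h17⟩ := h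
    exact ⟨h1, h2, h3, h4, h5, h6, h7, h8, h9, h10, h11, h12, h13, h14, h15, h16, h17⟩

section Basic

variable {M : Model.{u}} [hM : BasicModel M]

instance : CommSemiring M.carrier where
  add := M.add
  mul := M.mul
  zero := M.zero
  one := M.one
  add_assoc := hM.add_assoc
  add_comm := hM.add_comm
  add_zero := hM.add_zero
  zero_add a := (hM.add_comm _ _).trans (hM.add_zero a)
  mul_assoc := hM.mul_assoc
  mul_comm := hM.mul_comm
  mul_one := hM.mul_one
  one_mul a := (hM.mul_comm _ _).trans (hM.mul_one a)
  mul_zero := hM.mul_zero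
  zero_mul a := (hM.mul_comm _ _).trans (hM.mul_zero a)
  left_distrib := hM.mul_add
  right_distrib a b c := by
    change M.mul (M.add a b) c = M.add (M.mul a c) (M.mul b c)
    rw [hM.mul_comm, hM.mul_add, hM.mul_comm c, hM.mul_comm c]
  nsmul := @nsmulRec _ ⟨M.zero⟩ ⟨M.add⟩
  nsmul_zero _ := rfl
  nsmul_succ _ _ := rfl
  npow := @npowRec _ ⟨M.one⟩ ⟨M.mul⟩
  npow_zero _ := rfl
  npow_succ _ _ := rfl

open Classical in
noncomputable instance : LinearOrder M.carrier where
  lt := M.lt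
  le a b := M.lt a b ∨ a = b
  le_refl a := .inr rfl
  le_trans a b c := by
    rintro (h | rfl) (h' | rfl)
    · exact .inl (hM.lt_trans _ _ _ ⟨h, h'⟩)
    · exact .inl h
    · exact .inl h'
    · exact .inr rfl
  le_antisymm a b := by
    rintro (h | rfl) (h' | h')
    · exact absurd (hM.lt_trans _ _ _ ⟨h, h'⟩) (hM.lt_irrefl _)
    all_goals simp_all
  lt_iff_le_not_ge a b := by
    constructor
    · refine fun h => ⟨.inl h, ?_⟩
      rintro (h' | rfl)
      · exact hM.lt_irrefl _ (hM.lt_trans _ _ _ ⟨h, h'⟩)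
      · exact hM.lt_irrefl _ h
    · rintro ⟨h | rfl, h'⟩
      · exact h
      · exact absurd (.inr rfl) h'
  le_total a b := by
    rcases hM.lt_tri a b with h | h | h
    · exact .inl (.inl h)
    · exact .inl (.inr h)
    · exact .inr (.inl h)
  toDecidableLE := Classical.decRel _

instance : IsStrictOrderedRing M.carrier :=
  have add_lt : ∀ a b : M.carrier, a < b → ∀ c, a + c < b + c := fun a b h c => hM.add_lt a b c h
  have mul_lt : ∀ a b c : M.carrier, 0 < c → a < b → a * c < b * c :=
    fun a b c h h' => hM.mul_lt a b c ⟨h, h'⟩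
  { add_le_add_left := fun a b h c => by
      rcases h.lt_or_eq with h | rfl
      · exact (add_lt a b h c).le
      · exact le_rfl
    le_of_add_le_add_left := fun a b c h => by
      by_contra! h'
      have := add_lt _ _ h' a
      rw [add_comm c, add_comm b] at this
      exact absurd h this.not_ge
    zero_le_one := (show (0 : M.carrier) < 1 from hM.zero_lt_one).le
    exists_pair_ne := ⟨0, 1, (show (0 : M.carrier) < 1 from hM.zero_lt_one).ne⟩
    mul_lt_mul_of_pos_left := fun a ha b c h => by
      simpa only [mul_comm] using mul_lt b c a ha h
    mul_lt_mul_of_pos_right := fun a ha b c h => mul_lt b c a ha h }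

noncomputable instance : PartialOrder M.carrier := inferInstance
noncomputable instance : Preorder M.carrier := inferInstance
noncomputable instance : LT M.carrier := inferInstance
noncomputable instance : LE M.carrier := inferInstance

theorem BasicModel.nonneg (a : M.carrier) : 0 ≤ a := (hM.zero_le a).elim (.inr) (.inl)

instance : CanonicallyOrderedAdd M.carrier where
  exists_add_of_le {a b} h := by
    rcases h.lt_or_eq with h | rfl
    · obtain ⟨c, hc⟩ := hM.exists_add a b h
      exact ⟨c, hc.symm⟩
    · exact ⟨0, (add_zero _).symm⟩
  le_add_self a b := le_add_of_nonneg_left (BasicModel.nonneg b)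
  le_self_add a b := le_add_of_nonneg_right (BasicModel.nonneg b)

theorem BasicModel.add_one_le {a b : M.carrier} (h : a < b) : a + 1 ≤ b := by
  obtain ⟨c, rfl⟩ := exists_add_of_le h.le
  have hc : 0 < c := by
    rcases (BasicModel.nonneg c).lt_or_eq with h' | rfl
    · exact h'
    · simp at h
  have : (1 : M.carrier) ≤ c := (hM.one_le c hc).elim .inr .inl
  gcongr

theorem BasicModel.lt_add_one {a b : M.carrier} : a < b + 1 ↔ a ≤ b := by
  refine ⟨fun h => ?_, fun h => h.trans_lt (_root_.lt_add_one b)⟩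
  by_contra! h'
  exact absurd (BasicModel.add_one_le h') h.not_ge

theorem BasicModel.eq_zero_or_succ (a : M.carrier) : a = 0 ∨ ∃ b, a = b + 1 := by
  rcases (BasicModel.nonneg a).lt_or_eq with h | rfl
  · have := BasicModel.add_one_le h
    obtain ⟨c, rfl⟩ := exists_add_of_le this
    exact .inr ⟨c, by ring⟩
  · exact .inl rfl

end Basic

/-! ## Definability by bounded formulas with parameters -/

section Definability

variable {M : Model.{u}} [hM : BasicModel M]

/-- Functions of a tuple that are given by terms with parameters. -/
class inductive TermFn : {n : ℕ} → ((Fin n → M.carrier) → M.carrier) → Prop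
  | var {n : ℕ} (i : Fin n) : TermFn fun v => v i
  | const {n : ℕ} (c : M.carrier) : TermFn fun _ : Fin n → M.carrier => c
  | add {n : ℕ} {f g : (Fin n → M.carrier) → M.carrier} :
    TermFn f → TermFn g → TermFn fun v => f v + g v
  | mul {n : ℕ} {f g : (Fin n → M.carrier) → M.carrier} :
    TermFn f → TermFn g → TermFn fun v => f v * g v

/-- Relations that are given by bounded-quantifier formulas with number and set parameters. -/
class inductive D0 : {n : ℕ} → ((Fin n → M.carrier) → Prop) → Prop
  | eq {n : ℕ} {f g : (Fin n → M.carrier) → M.carrier} :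
    TermFn f → TermFn g → D0 fun v => f v = g v
  | lt {n : ℕ} {f g : (Fin n → M.carrier) → M.carrier} :
    TermFn f → TermFn g → D0 fun v => f v < g v
  | mem {n : ℕ} {f : (Fin n → M.carrier) → M.carrier} (S : M.sets) :
    TermFn f → D0 fun v => f v ∈ (S : Set M.carrier)
  | not {n : ℕ} {P : (Fin n → M.carrier) → Prop} : D0 P → D0 fun v => ¬ P v
  | and {n : ℕ} {P P' : (Fin n → M.carrier) → Prop} : D0 P → D0 P' → D0 fun v => P v ∧ P' v
  | allLT {n : ℕ} {f : (Fin n → M.carrier) → M.carrier}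
    {P : M.carrier → (Fin n → M.carrier) → Prop} : TermFn f →
    D0 (fun w : Fin (n + 1) → M.carrier => P (w 0) (fun i => w i.succ)) →
    D0 fun v => ∀ a, a < f v → P a v

/-! ### Closure properties of bounded definability -/

section Instances

variable {n : ℕ} {f g : (Fin n → M.carrier) → M.carrier} {P P' : (Fin n → M.carrier) → Prop}

instance (i : Fin n) : TermFn fun v : Fin n → M.carrier => v i := .var i
instance (c : M.carrier) : TermFn fun _ : Fin n → M.carrier => c := .const c
instance [hf : TermFn f] [hg : TermFn g] : TermFn fun v => f v + g v := .add hf hg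
instance [hf : TermFn f] [hg : TermFn g] : TermFn fun v => f v * g v := .mul hf hg

instance [hf : TermFn f] [hg : TermFn g] : D0 fun v => f v = g v := .eq hf hg
instance [hf : TermFn f] [hg : TermFn g] : D0 fun v => f v < g v := .lt hf hg
instance [hf : TermFn f] (S : M.sets) : D0 fun v => f v ∈ (S : Set M.carrier) := .mem S hf
instance [h : D0 P] : D0 fun v => ¬ P v := .not h
instance [h : D0 P] [h' : D0 P'] : D0 fun v => P v ∧ P' v := .and h h'
instance [h : D0 P] [h' : D0 P'] : D0 fun v => P v ∨ P' v := by
  convert D0.not (D0.and (D0.not h) (D0.not h')) using 2; tauto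
instance [h : D0 P] [h' : D0 P'] : D0 fun v => P v → P' v := by
  convert D0.not (D0.and h (D0.not h')) using 2; tauto
instance [h : D0 P] [h' : D0 P'] : D0 fun v => P v ↔ P' v := by
  have : D0 fun v => (P v → P' v) ∧ (P' v → P v) := inferInstance
  convert this using 2; exact iff_def
instance [hf : TermFn f] [hg : TermFn g] : D0 fun v => f v ≤ g v := by
  convert D0.not (D0.lt hg hf) using 2; exact not_lt.symm
instance [hf : TermFn f] [hg : TermFn g] : D0 fun v => f v ≠ g v := D0.not (D0.eq hf hg)
instance {P : M.carrier → (Fin n → M.carrier) → Prop} [hf : TermFn f]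
    [h : D0 (fun w : Fin (n + 1) → M.carrier => P (w 0) (fun i => w i.succ))] :
    D0 fun v => ∀ a, a < f v → P a v := .allLT hf h
instance D0.exLT {P : M.carrier → (Fin n → M.carrier) → Prop} [hf : TermFn f]
    [h : D0 (fun w : Fin (n + 1) → M.carrier => P (w 0) (fun i => w i.succ))] :
    D0 fun v => ∃ a, a < f v ∧ P a v := by
  convert D0.not (D0.allLT (P := fun a v => ¬ P a v) hf (D0.not h)) using 2
  push Not; rfl

theorem TermFn.comp {m : ℕ} {σ : Fin n → (Fin m → M.carrier) → M.carrier} (hf : TermFn f)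
    (hσ : ∀ i, TermFn (σ i)) : TermFn fun v => f fun i => σ i v := by
  induction hf with
  | var i => exact hσ i
  | const c => exact .const c
  | add _ _ h h' => exact .add h h'
  | mul _ _ h h' => exact .mul h h'

theorem D0.comp {m : ℕ} {σ : Fin n → (Fin m → M.carrier) → M.carrier} (hP : D0 P)
    (hσ : ∀ i, TermFn (σ i)) : D0 fun v => P fun i => σ i v := by
  induction hP generalizing m with
  | eq h h' => exact .eq (h.comp hσ) (h'.comp hσ)
  | lt h h' => exact .lt (h.comp hσ) (h'.comp hσ)
  | mem S h => exact .mem S (h.comp hσ)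
  | not _ h => exact .not (h hσ)
  | and _ _ h h' => exact .and (h hσ) (h' hσ)
  | allLT hf _ h =>
    refine .allLT (hf.comp hσ) ?_
    -- The bound variable stays at position `0`; the substituted functions only see the remaining
    -- positions.
    exact h (σ := Fin.cons (fun w => w 0) fun i w => σ i fun j => w j.succ)
      (Fin.cases (.var 0) fun i => (hσ i).comp fun j => .var j.succ)

end Instances

/-- The tuple whose entries are taken from `v` or are parameters, as prescribed by `p`. -/
def pick {n N : ℕ} (p : Fin N → Fin n ⊕ M.carrier) (v : Fin n → M.carrier) : Fin N → M.carrier :=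
  fun i => Sum.elim v id (p i)

omit hM in
theorem pick_append {n N N' : ℕ} (p : Fin N → Fin n ⊕ M.carrier) (p' : Fin N' → Fin n ⊕ M.carrier)
    (v : Fin n → M.carrier) : (fun i => pick (Fin.append p p') v (Fin.castAdd N' i)) = pick p v ∧
      (fun i => pick (Fin.append p p') v (Fin.natAdd N i)) = pick p' v := by
  simp only [pick, Fin.append_left, Fin.append_right]; exact ⟨rfl, rfl⟩

theorem TermFn.exists_term {n : ℕ} {f : (Fin n → M.carrier) → M.carrier} (hf : TermFn f) :
    ∃ (N : ℕ) (t : Term N) (p : Fin N → Fin n ⊕ M.carrier), ∀ v, f v = t.val M (pick p v) := by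
  induction hf with
  | var i => exact ⟨1, .var 0, fun _ => .inl i, fun v => rfl⟩
  | const c => exact ⟨1, .var 0, fun _ => .inr c, fun v => rfl⟩
  | add _ _ h h' =>
    obtain ⟨N, t, p, h⟩ := h
    obtain ⟨N', t', p', h'⟩ := h'
    refine ⟨N + N', .add (t.subst fun i => .var (i.castAdd N')) (t'.subst fun i => .var (i.natAdd N)),
      Fin.append p p', fun v => ?_⟩
    simp only [h, h', Term.val, Term.val_subst, pick_append]
    rfl
  | mul _ _ h h' =>
    obtain ⟨N, t, p, h⟩ := h
    obtain ⟨N', t', p', h'⟩ := h'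
    refine ⟨N + N', .mul (t.subst fun i => .var (i.castAdd N')) (t'.subst fun i => .var (i.natAdd N)),
      Fin.append p p', fun v => ?_⟩
    simp only [h, h', Term.val, Term.val_subst, pick_append]
    rfl

/-- Subformulas come with their own number and set parameters, so binary connectives concatenate the
two parameter lists and rename variables accordingly. -/
theorem D0.exists_formula {n : ℕ} {P : (Fin n → M.carrier) → Prop} (hP : D0 P) :
    ∃ (N m : ℕ) (φ : Formula N m) (p : Fin N → Fin n ⊕ M.carrier) (V : Fin m → Set M.carrier),
      φ.IsBounded ∧ (∀ i, V i ∈ M.sets) ∧ ∀ v, P v ↔ φ.Sat M (pick p v) V := by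
  induction hP with
  | eq h h' =>
    obtain ⟨N, t, p, h⟩ := h.exists_term
    obtain ⟨N', t', p', h'⟩ := h'.exists_term
    refine ⟨N + N', 0, .eq (t.subst fun i => .var (i.castAdd N'))
      (t'.subst fun i => .var (i.natAdd N)), Fin.append p p', Fin.elim0, .eq _ _,
      fun i => i.elim0, fun v => ?_⟩
    simp only [h, h', Formula.Sat, Term.val, Term.val_subst, pick_append]
  | lt h h' =>
    obtain ⟨N, t, p, h⟩ := h.exists_term
    obtain ⟨N', t', p', h'⟩ := h'.exists_term
    refine ⟨N + N', 0, .lt (t.subst fun i => .var (i.castAdd N'))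
      (t'.subst fun i => .var (i.natAdd N)), Fin.append p p', Fin.elim0, .lt _ _,
      fun i => i.elim0, fun v => ?_⟩
    simp only [h, h', Formula.Sat, Term.val, Term.val_subst, pick_append]
    rfl
  | mem S h =>
    obtain ⟨N, t, p, h⟩ := h.exists_term
    refine ⟨N, 1, .mem t 0, p, fun _ => S, .mem _ _, fun _ => S.2, fun v => ?_⟩
    simp only [h, Formula.Sat]
  | not _ h =>
    obtain ⟨N, m, φ, p, V, hφ, hV, h⟩ := h
    exact ⟨N, m, .neg φ, p, V, .neg hφ, hV, fun v => not_congr (h v)⟩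
  | and _ _ h h' =>
    obtain ⟨N, m, φ, p, V, hφ, hV, h⟩ := h
    obtain ⟨N', m', φ', p', V', hφ', hV', h'⟩ := h'
    refine ⟨N + N', m + m',
      .and (φ.subst (fun i => .var (i.castAdd N')) fun i => i.castAdd m')
        (φ'.subst (fun i => .var (i.natAdd N)) fun i => i.natAdd m),
      Fin.append p p', Fin.append V V', .and (hφ.subst _ _) (hφ'.subst _ _),
      fun i => Fin.addCases (fun i => by rw [Fin.append_left]; exact hV i)
        (fun i => by rw [Fin.append_right]; exact hV' i) i, fun v => ?_⟩
    simp only [h, h', Formula.Sat, Formula.sat_subst, Term.val, pick_append, Fin.append_left,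
      Fin.append_right]
  | @allLT n f P hf _ h =>
    obtain ⟨N, t, p, hf⟩ := hf.exists_term
    obtain ⟨N', m, φ, p', V, hφ, hV, h⟩ := h
    -- Where the body refers to the bound variable, `σ` substitutes `var 0`, so the entry `0` that
    -- `q` puts there is a dummy.
    let q : Fin N' → Fin n ⊕ M.carrier := fun i =>
      Sum.elim (Fin.cases (.inr 0) .inl) .inr (p' i)
    let σ : Fin N' → Term (N + N' + 1) := fun i =>
      Sum.elim (Fin.cases (.var 0) fun _ => .var (i.natAdd N).succ)
        (fun _ => .var (i.natAdd N).succ) (p' i)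
    refine ⟨N + N', m, .allLT (t.subst fun i => .var (i.castAdd N')) (φ.subst σ id),
      Fin.append p q, V, .allLT _ (hφ.subst _ _), hV, fun v => ?_⟩
    simp only [Formula.allLT, Formula.Sat, Formula.sat_subst, Term.val_up, Term.val_subst]
    refine forall_congr' fun a => ?_
    have h1 : M.lt a (f v) ↔ a < f v := Iff.rfl
    rw [hf v] at h1 ⊢
    have := h (Fin.cons a v)
    refine imp_congr ?_ ?_
    · simp only [Term.val, pick_append]; exact h1.symm
    · refine this.trans (iff_of_eq ?_)
      congr 1
      funext i
      have e : pick (Fin.append p q) v (Fin.natAdd N i) = pick q v i := congrFun (pick_append p q v).2 i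
      rcases hi : p' i with j | c
      · refine Fin.cases (fun hi => ?_) (fun j hi => ?_) j hi
        · simp only [pick, σ, hi]; rfl
        · have : σ i = .var (i.natAdd N).succ := by simp only [σ, hi]; rfl
          rw [this]; simp only [Term.val, Fin.cons_succ, e]
          simp only [pick, q, hi]; rfl
      · have : σ i = .var (i.natAdd N).succ := by simp only [σ, hi]; rfl
        rw [this]; simp only [Term.val, Fin.cons_succ, e]
        simp only [pick, q, hi]; rfl

theorem D0.exists_formula₂ {P : M.carrier → M.carrier → Prop}
    (hP : D0 fun v : Fin 2 → M.carrier => P (v 0) (v 1)) :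
    ∃ (N m : ℕ) (φ : Formula (N + 1 + 1) m) (w : Fin N → M.carrier) (V : Fin m → Set M.carrier),
      φ.IsBounded ∧ (∀ i, V i ∈ M.sets) ∧
      ∀ a x, P a x ↔ φ.Sat M (Fin.cons a (Fin.cons x w : Fin (N + 1) → M.carrier) :
        Fin (N + 1 + 1) → M.carrier) V := by
  obtain ⟨N, m, φ, p, V, hφ, hV, h⟩ := hP.exists_formula
  let σ : Fin N → Term (N + 1 + 1) := fun i =>
    Sum.elim (fun j => if j = 0 then .var 0 else .var 1) (fun _ => .var i.succ.succ) (p i)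
  refine ⟨N, m, φ.subst σ id, fun i => Sum.elim (fun _ => 0) id (p i), V, hφ.subst _ _, hV,
    fun a x => ?_⟩
  rw [Formula.sat_subst]
  refine (h ![a, x]).trans (iff_of_eq ?_)
  congr 1
  funext i
  rcases hi : p i with j | c
  · fin_cases j <;> (simp only [pick, σ, hi]; rfl)
  · have : σ i = .var i.succ.succ := by simp only [σ, hi]; rfl
    rw [this]; simp only [Term.val, Fin.cons_succ, pick, hi]; rfl

/-- The models of `RCA₀`, described by `Σ⁰₁` induction and `Δ⁰₁` comprehension for relations. -/
class RCAModel (M : Model.{u}) : Prop extends BasicModel M where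
  ind' : ∀ P : M.carrier → M.carrier → Prop, D0 (fun v : Fin 2 → M.carrier => P (v 0) (v 1)) →
    (∃ a, P a 0) → (∀ x, (∃ a, P a x) → ∃ a, P a (x + 1)) → ∀ x, ∃ a, P a x
  comp' : ∀ P P' : M.carrier → M.carrier → Prop,
    D0 (fun v : Fin 2 → M.carrier => P (v 0) (v 1)) →
    D0 (fun v : Fin 2 → M.carrier => P' (v 0) (v 1)) →
    (∀ x, (∃ a, P a x) ↔ ∀ a, P' a x) → {x | ∃ a, P a x} ∈ M.sets

/-- The models of `ACA₀`. -/
class ACAModel (M : Model.{u}) : Prop extends RCAModel M where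
  sigma' : ∀ P : M.carrier → M.carrier → Prop, D0 (fun v : Fin 2 → M.carrier => P (v 0) (v 1)) →
    {x | ∃ a, P a x} ∈ M.sets

end Definability

/-! ### Models of the axioms are models in the relational sense -/

theorem rcaModel_of_satisfies (M : Model.{u}) (h : ∀ ψ ∈ RCA₀, M.Satisfies ψ) : RCAModel M := by
  have hM : BasicModel M := (basicModel_iff M).2 fun ψ hψ => h ψ (.inl (.inl hψ))
  refine { hM with ind' := ?_, comp' := ?_ }
  · intro P hP h0 hs
    obtain ⟨N, m, φ, w, V, hφ, hV, h'⟩ := hP.exists_formula₂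
    have := (satisfies_inductionFor M _).1 (h _ (.inl (.inr ⟨N, m, .ex φ, ⟨φ, hφ, rfl⟩, rfl⟩))) V hV w
    simp only [Formula.Sat, ← h'] at this
    exact this ⟨h0, hs⟩
  · intro P P' hP hP' heq
    obtain ⟨N, m, φ, w, V, hφ, hV, h1⟩ := hP.exists_formula₂
    obtain ⟨N', m', φ', w', V', hφ', hV', h2⟩ := hP'.exists_formula₂
    -- The axiom requires both formulas to have the same free variables: the witness and the
    -- argument are shared, the parameters are placed side by side.
    let σ : Fin (N + 1 + 1) → Term (N + N' + 1 + 1) :=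
      Fin.cons (.var 0) (Fin.cons (.var 1) fun i => .var (i.castAdd N').succ.succ)
    let σ' : Fin (N' + 1 + 1) → Term (N + N' + 1 + 1) :=
      Fin.cons (.var 0) (Fin.cons (.var 1) fun i => .var (i.natAdd N).succ.succ)
    have := (satisfies_deltaComprehensionFor M _ _).1 (h _ (.inr ⟨N + N', m + m',
      .ex (φ.subst σ fun i => i.castAdd m'), .all (φ'.subst σ' fun i => i.natAdd m),
      ⟨_, hφ.subst _ _, rfl⟩, ⟨_, hφ'.subst _ _, rfl⟩, rfl⟩)) (Fin.append V V')
      (fun i => Fin.addCases (fun i => by rw [Fin.append_left]; exact hV i)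
        (fun i => by rw [Fin.append_right]; exact hV' i) i) (Fin.append w w')
    simp only [Formula.Sat, Formula.sat_subst, Fin.append_left, Fin.append_right, σ, σ',
      cons_comp, Term.val, Fin.cons_succ] at this
    simp only [h1, h2] at heq ⊢
    exact this heq

theorem acaModel_of_satisfies (M : Model.{u}) (h : ∀ ψ ∈ ACA₀, M.Satisfies ψ) : ACAModel M := by
  have hM : BasicModel M := (basicModel_iff M).2 fun ψ hψ => h ψ (.inl (.inl hψ))
  have sigma : ∀ P : M.carrier → M.carrier → Prop,
      D0 (fun v : Fin 2 → M.carrier => P (v 0) (v 1)) → {x | ∃ a, P a x} ∈ M.sets := by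
    intro P hP
    obtain ⟨N, m, φ, w, V, hφ, hV, h'⟩ := hP.exists_formula₂
    have := (satisfies_comprehensionFor M _).1
      (h _ (.inr ⟨N, m, .ex φ, hφ.isArithmetical, rfl⟩)) V hV w
    simpa only [Formula.Sat, ← h'] using this
  refine { hM with ind' := ?_, comp' := fun P _ hP _ _ => sigma P hP, sigma' := sigma }
  intro P hP h0 hs
  -- Σ⁰₁ induction is set induction for the set that Σ⁰₁ comprehension provides.
  exact (show ∀ A ∈ M.sets, _ from h _ (.inl (.inr rfl))) _ (sigma P hP) ⟨h0, hs⟩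

/-! ### The pairing function and bounded divisibility -/

section Pairing

variable {M : Model.{u}} [hM : BasicModel M]

theorem not_lt_zero' (a : M.carrier) : ¬ a < 0 := (BasicModel.nonneg a).not_gt

/-- The pairing function. -/
def pr (a b : M.carrier) : M.carrier := (a + b) * (a + b) + a

instance {n : ℕ} {f g : (Fin n → M.carrier) → M.carrier} [TermFn f] [TermFn g] :
    TermFn fun v => pr (f v) (g v) := by unfold pr; infer_instance

theorem le_mul_self' (a : M.carrier) : a ≤ a * a := by
  rcases BasicModel.eq_zero_or_succ a with rfl | ⟨b, rfl⟩
  · simp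
  · calc b + 1 ≤ (b + 1) + (b + 1) * b := le_self_add
      _ = _ := by ring

theorem le_pr_left (a b : M.carrier) : a ≤ pr a b := le_add_self

theorem le_pr_right (a b : M.carrier) : b ≤ pr a b :=
  (le_add_self.trans (le_mul_self' (a + b))).trans le_self_add

/-- The codes of pairs with sum `n` lie in the interval from `n²` to `n² + n`, hence below `(n +
1)²`. -/
theorem pr_lt_pr_of_add_lt {a b c d : M.carrier} (h : a + b < c + d) : pr a b < pr c d := by
  obtain ⟨e, he⟩ := exists_add_of_le (BasicModel.add_one_le h)
  calc pr a b < pr a b + (a + 2 * b + 1) := by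
        refine lt_add_of_pos_right _ ?_
        exact lt_of_lt_of_le zero_lt_one le_add_self
    _ = (a + b + 1) * (a + b + 1) := by unfold pr; ring
    _ ≤ (c + d) * (c + d) := by
        have := BasicModel.add_one_le h
        gcongr
    _ ≤ pr c d := le_self_add

theorem pr_inj {a b c d : M.carrier} (h : pr a b = pr c d) : a = c ∧ b = d := by
  rcases lt_trichotomy (a + b) (c + d) with h' | h' | h'
  · exact absurd h (pr_lt_pr_of_add_lt h').ne
  · unfold pr at h
    rw [h'] at h
    have := add_left_cancel h
    subst this
    exact ⟨rfl, add_left_cancel h'⟩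
  · exact absurd h (pr_lt_pr_of_add_lt h').ne'

theorem pr_inj_iff {a b c d : M.carrier} : pr a b = pr c d ↔ a = c ∧ b = d :=
  ⟨pr_inj, by rintro ⟨rfl, rfl⟩; rfl⟩

theorem pr_le_pr {a b c d : M.carrier} (h : a ≤ c) (h' : b ≤ d) : pr a b ≤ pr c d := by
  unfold pr; gcongr

theorem D0.comp₁ {P : M.carrier → Prop} (hP : D0 fun v : Fin 1 → M.carrier => P (v 0))
    {n : ℕ} (f : (Fin n → M.carrier) → M.carrier) [hf : TermFn f] : D0 fun v => P (f v) :=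
  hP.comp (σ := fun _ => f) fun _ => hf

theorem D0.comp₂ {P : M.carrier → M.carrier → Prop}
    (hP : D0 fun v : Fin 2 → M.carrier => P (v 0) (v 1))
    {n : ℕ} (f g : (Fin n → M.carrier) → M.carrier) [hf : TermFn f] [hg : TermFn g] :
    D0 fun v => P (f v) (g v) :=
  hP.comp (σ := ![f, g]) fun i => by fin_cases i <;> assumption

theorem dvd_iff_bounded (x y : M.carrier) : x ∣ y ↔ ∃ q < y + 1, y = x * q := by
  constructor
  · rintro ⟨q, rfl⟩
    rcases BasicModel.eq_zero_or_succ x with rfl | ⟨z, rfl⟩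
    -- Divisor `0` puts no bound on the quotient, so the quotient `0` is chosen.
    · exact ⟨0, by simp, by simp⟩
    · refine ⟨q, BasicModel.lt_add_one.2 ?_, rfl⟩
      calc q ≤ q + z * q := le_self_add
        _ = _ := by ring
  · rintro ⟨q, -, h⟩; exact ⟨q, h⟩

instance {n : ℕ} {f g : (Fin n → M.carrier) → M.carrier} [TermFn f] [TermFn g] :
    D0 fun v => f v ∣ g v :=
  D0.comp₂ (by simp only [dvd_iff_bounded]; infer_instance) f g

end Pairing

/-! ### Induction, comprehension and least elements in models of `RCA₀` -/

section RCA

variable {M : Model.{u}} [hM : RCAModel M]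

theorem sigma_induction (P : M.carrier → M.carrier → Prop)
    (h0 : ∃ a, P a 0) (hs : ∀ x, (∃ a, P a x) → ∃ a, P a (x + 1)) (x : M.carrier)
    (hP : D0 fun v : Fin 2 → M.carrier => P (v 0) (v 1) := by infer_instance) : ∃ a, P a x :=
  hM.ind' P hP h0 hs x

theorem d0_induction (P : M.carrier → Prop) (h0 : P 0) (hs : ∀ x, P x → P (x + 1))
    (x : M.carrier) (hP : D0 fun v : Fin 1 → M.carrier => P (v 0) := by infer_instance) : P x := by
  have : D0 fun v : Fin 2 → M.carrier => P (v 1) := hP.comp₁ _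
  obtain ⟨_, h⟩ := sigma_induction (fun _ x => P x) ⟨0, h0⟩ (fun x ⟨_, h⟩ => ⟨0, hs x h⟩) x
  exact h

theorem delta_mem_sets (P P' : M.carrier → M.carrier → Prop)
    (h : ∀ x, (∃ a, P a x) ↔ ∀ a, P' a x)
    (hP : D0 fun v : Fin 2 → M.carrier => P (v 0) (v 1) := by infer_instance)
    (hP' : D0 fun v : Fin 2 → M.carrier => P' (v 0) (v 1) := by infer_instance) : {x | ∃ a, P a x} ∈ M.sets :=
  hM.comp' P P' hP hP' h

/-- The set of all numbers with a property that is given by a bounded formula. -/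
def setOfD0 (P : M.carrier → Prop)
    (hP : D0 fun v : Fin 1 → M.carrier => P (v 0) := by infer_instance) : M.sets :=
  ⟨{x | P x}, by
    have : D0 fun v : Fin 2 → M.carrier => P (v 1) := hP.comp₁ _
    simpa using delta_mem_sets (fun _ x => P x) (fun _ x => P x) (fun x => by simp)⟩

@[simp] theorem mem_setOfD0 {P : M.carrier → Prop}
    {hP : D0 fun v : Fin 1 → M.carrier => P (v 0)} {x : M.carrier} :
    x ∈ (setOfD0 P hP : Set M.carrier) ↔ P x := Iff.rfl

/-- If there were no least element, Σ⁰₁ induction on `k` would give one bound `w` below which every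
`y < k` has a counterexample. The uniform bound is what makes the induction formula Σ⁰₁. -/
theorem exists_least_pi (P : M.carrier → M.carrier → Prop)
    (h : ∃ x, ∀ a, P a x)
    (hP : D0 fun v : Fin 2 → M.carrier => P (v 0) (v 1) := by infer_instance) :
    ∃ x, (∀ a, P a x) ∧ ∀ y < x, ¬ ∀ a, P a y := by
  by_contra! hc
  have (n : ℕ) (f g : (Fin n → M.carrier) → M.carrier) [TermFn f] [TermFn g] :
    D0 fun v => P (f v) (g v) := hP.comp₂ f g
  obtain ⟨x, hx⟩ := h
  have key := sigma_induction (fun w k : M.carrier => ∀ y < k, ∃ z < w, ¬ P z y)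
    ⟨0, fun y hy => absurd hy (not_lt_zero' y)⟩ (fun k ⟨w, hw⟩ => by
      have : ¬ ∀ a, P a k := fun hk => by
        obtain ⟨y, hy, hy'⟩ := hc k hk
        obtain ⟨z, -, hz⟩ := hw y hy
        exact hz (hy' z)
      push Not at this
      obtain ⟨z, hz⟩ := this
      refine ⟨max w (z + 1), fun y hy => ?_⟩
      rcases (BasicModel.lt_add_one.1 hy).lt_or_eq with hy | rfl
      · obtain ⟨z', h, h'⟩ := hw y hy
        exact ⟨z', h.trans_le (le_max_left _ _), h'⟩
      · exact ⟨z, (lt_add_one z).trans_le (le_max_right _ _), hz⟩) (x + 1)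
  obtain ⟨w, hw⟩ := key
  obtain ⟨z, -, hz⟩ := hw x (lt_add_one x)
  exact hz (hx z)

theorem exists_least (P : M.carrier → Prop) (h : ∃ x, P x)
    (hP : D0 fun v : Fin 1 → M.carrier => P (v 0) := by infer_instance) : ∃ x, P x ∧ ∀ y < x, ¬ P y := by
  have : D0 fun v : Fin 2 → M.carrier => P (v 1) := hP.comp₁ _
  simpa using exists_least_pi (fun _ x => P x) (by simpa using h)

/-! ## Codes of finite sets -/

/-- `i` belongs to the finite set coded by `c`. -/
def MemC (i c : M.carrier) : Prop :=
  ∃ k a b, c = pr k (pr a b) ∧ i < k ∧ a * (i + 1) + 1 ∣ b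

/-- `c` codes a triple. -/
def IsTriple (c : M.carrier) : Prop := ∃ k a b : M.carrier, c = pr k (pr a b)

theorem MemC.lt {i c : M.carrier} (h : MemC i c) : i < c := by
  obtain ⟨k, a, b, rfl, h, -⟩ := h
  exact h.trans_le (le_pr_left _ _)

theorem memC_pr {i k a b : M.carrier} : MemC i (pr k (pr a b)) ↔ i < k ∧ a * (i + 1) + 1 ∣ b := by
  constructor
  · rintro ⟨k', a', b', h, h'⟩
    rw [pr_inj_iff, pr_inj_iff] at h
    obtain ⟨rfl, rfl, rfl⟩ := h
    exact h'
  · exact fun h => ⟨k, a, b, rfl, h⟩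

theorem triple_bounds (k a b : M.carrier) :
    k < pr k (pr a b) + 1 ∧ a < pr k (pr a b) + 1 ∧ b < pr k (pr a b) + 1 := by
  simp only [BasicModel.lt_add_one]
  exact ⟨le_pr_left _ _, (le_pr_left _ _).trans (le_pr_right _ _),
    (le_pr_right _ _).trans (le_pr_right _ _)⟩

theorem memC_iff_bounded (i c : M.carrier) : MemC i c ↔ ∃ k < c + 1, ∃ a < c + 1, ∃ b < c + 1,
    c = pr k (pr a b) ∧ i < k ∧ a * (i + 1) + 1 ∣ b := by
  constructor
  · rintro ⟨k, a, b, rfl, h⟩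
    obtain ⟨h1, h2, h3⟩ := triple_bounds k a b
    exact ⟨k, h1, a, h2, b, h3, rfl, h⟩
  · rintro ⟨k, -, a, -, b, -, h⟩
    exact ⟨k, a, b, h⟩

theorem isTriple_iff_bounded (c : M.carrier) : IsTriple c ↔ ∃ k < c + 1, ∃ a < c + 1, ∃ b < c + 1,
    c = pr k (pr a b) := by
  constructor
  · rintro ⟨k, a, b, rfl⟩
    obtain ⟨h1, h2, h3⟩ := triple_bounds k a b
    exact ⟨k, h1, a, h2, b, h3, rfl⟩
  · rintro ⟨k, -, a, -, b, -, h⟩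
    exact ⟨k, a, b, h⟩

instance {n : ℕ} {f g : (Fin n → M.carrier) → M.carrier} [TermFn f] [TermFn g] :
    D0 fun v => MemC (f v) (g v) :=
  D0.comp₂ (by simp only [memC_iff_bounded]; infer_instance) f g

instance {n : ℕ} {f : (Fin n → M.carrier) → M.carrier} [TermFn f] :
    D0 fun v => IsTriple (f v) :=
  D0.comp₁ (by simp only [isTriple_iff_bounded]; infer_instance) f

/-- `c` is the code of a finite set. -/
def IsCode (c : M.carrier) : Prop :=
  IsTriple c ∧ ∀ d, d < c ∧ IsTriple d → ¬ ∀ i, MemC i d ↔ MemC i c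

/-- Members of a coded set are smaller than its code, so comparing the sets coded by `d < c` and by
`c` only needs numbers below `c`. -/
theorem isCode_iff_bounded (c : M.carrier) : IsCode c ↔
    IsTriple c ∧ ∀ d < c, IsTriple d → ¬ ∀ i < c, MemC i d ↔ MemC i c := by
  refine and_congr_right fun _ => forall_congr' fun d => ?_
  have (hd : d < c) : (∀ i, MemC i d ↔ MemC i c) ↔ ∀ i < c, MemC i d ↔ MemC i c :=
    ⟨fun h i _ => h i, fun h i => ⟨fun h' => (h i (h'.lt.trans hd)).1 h',
      fun h' => (h i h'.lt).2 h'⟩⟩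
  grind

instance {n : ℕ} {f : (Fin n → M.carrier) → M.carrier} [TermFn f] :
    D0 fun v => IsCode (f v) :=
  D0.comp₁ (by simp only [isCode_iff_bounded]; infer_instance) f

theorem isCode_unique {c d : M.carrier} (hc : IsCode c) (hd : IsCode d)
    (h : ∀ i, MemC i c ↔ MemC i d) : c = d := by
  rcases lt_trichotomy c d with h' | h' | h'
  · exact absurd h (hd.2 c ⟨h', hc.1⟩)
  · exact h'
  · exact absurd (fun i => (h i).symm) (hc.2 d ⟨h', hd.1⟩)

theorem exists_isCode {c : M.carrier} (hc : IsTriple c) :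
    ∃ d, IsCode d ∧ ∀ i, MemC i d ↔ MemC i c := by
  obtain ⟨d, ⟨hd, hd'⟩, hl⟩ := exists_least_pi
    (fun i d => IsTriple d ∧ (MemC i d ↔ MemC i c)) ⟨c, fun _ => ⟨hc, Iff.rfl⟩⟩
    |>.imp fun d ⟨h, h'⟩ => (⟨⟨(h 0).1, fun i => (h i).2⟩, h'⟩ :
      (IsTriple d ∧ ∀ i, MemC i d ↔ MemC i c) ∧ _)
  refine ⟨d, ⟨hd, fun e ⟨he, he'⟩ h => hl e he fun i => ⟨he', (h i).trans (hd' i)⟩⟩, hd'⟩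

/-! ### Moduli of the β-function -/

theorem exists_common_multiple (k : M.carrier) :
    ∃ a : M.carrier, 0 < a ∧ ∀ d < k, 0 < d → d ∣ a := by
  refine sigma_induction (fun a k : M.carrier => 0 < a ∧ ∀ d < k, 0 < d → d ∣ a)
    ⟨1, zero_lt_one, fun d hd => absurd hd (not_lt_zero' d)⟩ (fun k ⟨a, ha, h⟩ => ?_) k
  rcases (BasicModel.nonneg k).lt_or_eq with hk | rfl
  · refine ⟨a * k, mul_pos ha hk, fun d hd hd' => ?_⟩
    rcases (BasicModel.lt_add_one.1 hd).lt_or_eq with hd | rfl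
    · exact (h d hd hd').mul_right k
    · exact dvd_mul_left _ _
  -- The factor `0` is left out of the product, to keep it positive.
  · exact ⟨a, ha, fun d hd hd' => absurd (BasicModel.lt_add_one.1 hd) hd'.not_ge⟩

theorem exists_modulus_multiple (a k : M.carrier) :
    ∃ b : M.carrier, 0 < b ∧ ∀ i < k, a * (i + 1) + 1 ∣ b := by
  refine sigma_induction (fun b k : M.carrier => 0 < b ∧ ∀ i < k, a * (i + 1) + 1 ∣ b)
    ⟨1, zero_lt_one, fun d hd => absurd hd (not_lt_zero' d)⟩ (fun k ⟨b, hb, h⟩ => ?_) k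
  refine ⟨b * (a * (k + 1) + 1), mul_pos hb (lt_of_lt_of_le zero_lt_one le_add_self),
    fun i hi => ?_⟩
  rcases (BasicModel.lt_add_one.1 hi).lt_or_eq with hi | rfl
  · exact (h i hi).mul_right _
  · exact dvd_mul_left _ _

theorem dvd_of_dvd_add {p x y : M.carrier} (h : p ∣ x + y) (h' : p ∣ x) : p ∣ y := by
  obtain ⟨r, hr⟩ := h
  obtain ⟨s, rfl⟩ := h'
  rcases (BasicModel.nonneg p).lt_or_eq with hp | rfl
  · have : s ≤ r := by
      have : p * s ≤ p * r := hr ▸ le_self_add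
      exact le_of_mul_le_mul_left this hp
    obtain ⟨t, rfl⟩ := exists_add_of_le this
    rw [mul_add] at hr
    exact ⟨t, add_left_cancel hr⟩
  · simp at hr; simp [hr]

/-- The moduli `a (u + 1) + 1` and `a (v + 1) + 1` are coprime if `a` is a multiple of the
difference of `u` and `v`. -/
theorem modulus_dvd_of_dvd_mul {a u v q : M.carrier} (huv : u ≠ v)
    (ha : ∀ d, 0 < d → d ≤ u ∨ d ≤ v → d ∣ a)
    (h : a * (u + 1) + 1 ∣ (a * (v + 1) + 1) * q) : a * (u + 1) + 1 ∣ q := by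
  set p := a * (u + 1) + 1 with hp
  -- `p` is `1` modulo `a`: in `p * x = a * x * (u + 1) + x` the first summand is divisible by `p`,
  -- hence so is `x`.
  have cancel : ∀ x, p ∣ a * x → p ∣ x := fun x hx => by
    have h1 : p ∣ (a * x) * (u + 1) := hx.mul_right _
    refine dvd_of_dvd_add (x := (a * x) * (u + 1)) ?_ h1
    exact ⟨x, by rw [hp]; ring⟩
  -- After cancelling `a`, the factor `d` is completed to `a = d * e` and `a` is cancelled once
  -- more. No Bézout identity is needed.
  have step : ∀ d, 0 < d → d ≤ u ∨ d ≤ v → p ∣ a * (d * q) → p ∣ q := fun d hd hd' hx => by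
    obtain ⟨e, he⟩ := ha d hd hd'
    refine cancel q ?_
    rw [he]
    have := (cancel _ hx).mul_right e
    rwa [show d * q * e = d * e * q by ring] at this
  rcases lt_or_gt_of_ne huv with hlt | hlt
  -- The two moduli differ by `a * d`, with `d` the distance of `u` and `v`; without subtraction
  -- each order of `u` and `v` needs its own identity.
  · obtain ⟨d, rfl⟩ := exists_add_of_le hlt.le
    refine step d (by simpa using hlt) (.inr le_add_self) ?_
    refine dvd_of_dvd_add (x := p * q) ?_ (dvd_mul_right _ _)
    rwa [show p * q + a * (d * q) = (a * (u + d + 1) + 1) * q by rw [hp]; ring]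
  · obtain ⟨d, rfl⟩ := exists_add_of_le hlt.le
    refine step d (by simpa using hlt) (.inl le_add_self) ?_
    refine dvd_of_dvd_add (x := (a * (v + 1) + 1) * q) ?_ h
    exact ⟨q, by rw [hp]; ring⟩

/-- Bounded `Σ⁰₁` comprehension, by codes. -/
theorem exists_code_sigma (T : M.sets) (k : M.carrier) : ∃ c : M.carrier, IsCode c ∧
    ∀ i, MemC i c ↔ i < k ∧ ∃ s, pr i s ∈ (T : Set M.carrier) := by
  obtain ⟨a, ha₀, ha⟩ := exists_common_multiple k
  obtain ⟨b₀, hb₀, hb₀'⟩ := exists_modulus_multiple a k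
  -- The condition on `b` is Π⁰₁, although the set to be coded is Σ⁰₁. Minimality will exclude the
  -- unwanted members.
  obtain ⟨b, ⟨hb, hb'⟩, hl⟩ := exists_least_pi (fun s b => 0 < b ∧
      ∀ i < k, pr i s ∈ (T : Set M.carrier) → a * (i + 1) + 1 ∣ b)
    ⟨b₀, fun s => ⟨hb₀, fun i hi _ => hb₀' i hi⟩⟩
    |>.imp fun d ⟨h, h'⟩ => (⟨⟨(h 0).1, fun i hi s => (h s).2 i hi⟩, h'⟩ :
      (0 < d ∧ ∀ i < k, ∀ s, pr i s ∈ (T : Set M.carrier) → a * (i + 1) + 1 ∣ d) ∧ _)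
  obtain ⟨c, hc, hc'⟩ := exists_isCode (c := pr k (pr a b)) ⟨_, _, _, rfl⟩
  refine ⟨c, hc, fun i => (hc' i).trans (memC_pr.trans (and_congr_right fun hi =>
    ⟨fun hd => ?_, fun ⟨s, hs⟩ => hb' i hi s hs⟩))⟩
  -- If the modulus of a nonmember `i` divided `b`, the quotient would be smaller than `b`, still
  -- positive, and by coprimality still divisible by the modulus of every member.
  by_contra! hn
  obtain ⟨q, rfl⟩ := hd
  have hq : 0 < q := by
    rcases (BasicModel.nonneg q).lt_or_eq with h | rfl
    · exact h
    · simp at hb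
  have ha0 : 0 < a * (i + 1) := mul_pos ha₀ (lt_of_lt_of_le zero_lt_one le_add_self)
  refine hl q ?_ fun s => ⟨hq, fun j hj hjs => ?_⟩
  · calc q < q + a * (i + 1) * q := lt_add_of_pos_right _ (mul_pos ha0 hq)
      _ = _ := by ring
  · refine modulus_dvd_of_dvd_mul (v := i) (by rintro rfl; exact hn s hjs) (fun d hd hd' => ?_)
      (hb' j hj s hjs)
    exact ha d (hd'.elim (fun h => h.trans_lt hj) (fun h => h.trans_lt hi)) hd

theorem exists_code (S : M.sets) (k : M.carrier) : ∃ c : M.carrier, IsCode c ∧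
    ∀ i, MemC i c ↔ i < k ∧ i ∈ (S : Set M.carrier) := by
  obtain ⟨c, hc, h⟩ := exists_code_sigma
    (setOfD0 fun x => ∃ i < x + 1, ∃ s < x + 1, x = pr i s ∧ i ∈ (S : Set M.carrier)) k
  refine ⟨c, hc, fun i => (h i).trans (and_congr_right fun _ => ⟨?_, fun hi => ?_⟩)⟩
  · rintro ⟨s, j, -, t, -, h, h'⟩
    rwa [(pr_inj h).1]
  · exact ⟨0, i, BasicModel.lt_add_one.2 (le_pr_left _ _), 0, BasicModel.lt_add_one.2
      (le_pr_right _ _), rfl, hi⟩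

/-- Strong `Σ⁰₁` bounding. -/
theorem exists_bound (T : M.sets) (k : M.carrier) : ∃ B : M.carrier, ∀ i < k,
    (∃ s, pr i s ∈ (T : Set M.carrier)) → ∃ s < B, pr i s ∈ (T : Set M.carrier) := by
  -- With the code `c`, the hypothesis that a witness exists becomes the bounded statement `MemC i
  -- c`, and Σ⁰₁ induction applies.
  obtain ⟨c, -, hc⟩ := exists_code_sigma T k
  obtain ⟨B, hB⟩ := sigma_induction
    (fun B j : M.carrier => ∀ i < j, MemC i c → ∃ s < B, pr i s ∈ (T : Set M.carrier))
    ⟨0, fun y hy => absurd hy (not_lt_zero' y)⟩ (fun j ⟨B, hB⟩ => by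
      by_cases hj : MemC j c
      · obtain ⟨-, s, hs⟩ := (hc j).1 hj
        refine ⟨max B (s + 1), fun i hi h => ?_⟩
        rcases (BasicModel.lt_add_one.1 hi).lt_or_eq with hi | rfl
        · obtain ⟨t, ht, ht'⟩ := hB i hi h
          exact ⟨t, ht.trans_le (le_max_left _ _), ht'⟩
        · exact ⟨s, (lt_add_one s).trans_le (le_max_right _ _), hs⟩
      · refine ⟨B, fun i hi h => ?_⟩
        rcases (BasicModel.lt_add_one.1 hi).lt_or_eq with hi | rfl
        · exact hB i hi h
        · exact absurd h hj) k
  exact ⟨B, fun i hi h => hB i hi ((hc i).2 ⟨hi, h⟩)⟩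

/-- A sequence without repetitions is unbounded. -/
theorem exists_le_of_injective (F : M.sets) (x : M.carrier → M.carrier)
    (hF : ∀ i y, pr i y ∈ (F : Set M.carrier) ↔ y = x i) (hx : ∀ i j, i < j → x i ≠ x j)
    (i₀ V : M.carrier) : ∃ j, i₀ < j ∧ V ≤ x j := by
  by_contra! hc
  -- Bounding is applied to the inverse of the sequence after `i₀`: every value below `V` taken
  -- there is taken at some index below `B`. The value at index `max B (i₀ + 1)` is then a
  -- repetition.
  obtain ⟨B, hB⟩ := exists_bound (setOfD0 fun z => ∃ v < z + 1, ∃ j < z + 1, z = pr v j ∧ i₀ < j ∧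
    pr j v ∈ (F : Set M.carrier)) V
  have h1 : i₀ < max B (i₀ + 1) := (lt_add_one _).trans_le (le_max_right _ _)
  obtain ⟨s, hs, v, -, j, -, h, h', h''⟩ := hB (x (max B (i₀ + 1))) (hc _ h1)
    ⟨max B (i₀ + 1), _, BasicModel.lt_add_one.2 (le_pr_left _ _), _, BasicModel.lt_add_one.2
      (le_pr_right _ _), rfl, h1, (hF _ _).2 rfl⟩
  obtain ⟨rfl, rfl⟩ := pr_inj h
  exact hx _ _ (hs.trans_le (le_max_left _ _)) ((hF _ _).1 h'').symm

end RCA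

/-! ## The statement about finite powersets in a model -/

section Translation

variable {M : Model.{u}}

section

variable [hM : BasicModel M]

/-- `R` is a quasi-order on `Q`. -/
def IsQO (Q R : Set M.carrier) : Prop :=
  (∀ z, z ∈ R → ∃ x y, z = pr x y ∧ x ∈ Q ∧ y ∈ Q) ∧ (∀ x, x ∈ Q → pr x x ∈ R) ∧
  ∀ x y z, pr x y ∈ R ∧ pr y z ∈ R → pr x z ∈ R

/-- `F` is the graph of a function from the numbers to `Q`. -/
def IsSeq (F Q : Set M.carrier) : Prop :=
  (∀ z, z ∈ F → ∃ x y, z = pr x y ∧ y ∈ Q) ∧ (∀ x, ∃ y, pr x y ∈ F) ∧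
  ∀ x y z, pr x y ∈ F ∧ pr x z ∈ F → y = z

/-- `R` is a wqo on `Q` in the sense of the model. -/
def IsWqo (Q R : Set M.carrier) : Prop :=
  IsQO Q R ∧ ∀ F ∈ M.sets, IsSeq F Q →
    ∃ i j x y, i < j ∧ pr i x ∈ F ∧ pr j y ∈ F ∧ pr x y ∈ R

theorem Term.val_pair {n : ℕ} (v : Fin n → M.carrier) (s t : Term n) :
    (s.pair t).val M v = pr (s.val M v) (t.val M v) := rfl

theorem sat_isWQO {m : ℕ} (Q R : Fin m) (v : Fin 0 → M.carrier) (V : Fin m → Set M.carrier) :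
    (isWQO Q R).Sat M v V ↔ IsWqo (V Q) (V R) := Iff.rfl

end

variable [hM : RCAModel M]

theorem sat_memCoded {n m : ℕ} (i c : Term n) (v : Fin n → M.carrier)
    (V : Fin m → Set M.carrier) :
    (memCoded i c).Sat M v V ↔ MemC (i.val M v) (c.val M v) := by
  simp only [memCoded, Formula.Sat, Term.val_up, Term.val_pair, MemC]
  refine exists_congr fun k => exists_congr fun a => exists_congr fun b => ?_
  refine and_congr Iff.rfl (and_congr Iff.rfl (exists_congr fun q => ?_))
  -- The formula writes the quotient first, whereas `∣` has the divisor first.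
  rw [mul_comm, ← Term.val_up M i k v, ← Term.val_up M i.up a, ← Term.val_up M i.up.up b,
    ← Term.val_up M i.up.up.up q]
  exact Iff.rfl

theorem sat_isFiniteSetCode {n m : ℕ} (c : Term n) (v : Fin n → M.carrier)
    (V : Fin m → Set M.carrier) : (isFiniteSetCode c).Sat M v V ↔ IsCode (c.val M v) := by
  simp only [isFiniteSetCode, isTriple, Formula.Sat, Formula.sat_iff, sat_memCoded, Term.val_up]
  exact and_congr Iff.rfl (forall_congr' fun d => imp_congr Iff.rfl
    (not_congr (forall_congr' fun i => Iff.comm)))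

/-- `P` is the set of codes of finite subsets of `Q`. -/
def IsPow (P Q : Set M.carrier) : Prop :=
  ∀ c, c ∈ P ↔ IsCode c ∧ ∀ i, MemC i c → i ∈ Q

/-- `L` is the relation `≤^♭` on `P`. -/
def IsFlat (L P R : Set M.carrier) : Prop :=
  ∀ z, z ∈ L ↔ ∃ c d, z = pr c d ∧ c ∈ P ∧ d ∈ P ∧
    ∀ x, MemC x c → ∃ y, MemC y d ∧ pr x y ∈ R

theorem satisfies_flatWQO : M.Satisfies flatWQO ↔ ∀ Q ∈ M.sets, ∀ R ∈ M.sets, IsWqo Q R →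
    ∃ P ∈ M.sets, ∃ L ∈ M.sets, IsPow P Q ∧ IsFlat L P R ∧ IsWqo P L := by
  simp only [flatWQO, Model.Satisfies, Formula.Sat, isFinitePowerset, isFlatOrder,
    Formula.sat_iff, sat_memCoded, sat_isFiniteSetCode, sat_isWQO]
  exact Iff.rfl

end Translation

/-! ## Existence of a `Σ⁰₁` set from well-quasi-orders of finite powersets -/

section Reversal

variable {M : Model.{u}} [hM : RCAModel M]

/-- The stages `s` and `t` agree below `v`. -/
def Agree (T : M.sets) (v s t : M.carrier) : Prop :=
  ∀ u < v, pr u s ∈ (T : Set M.carrier) ↔ pr u t ∈ (T : Set M.carrier)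

instance (T : M.sets) {n : ℕ} {f g h : (Fin n → M.carrier) → M.carrier}
    [hf : TermFn f] [hg : TermFn g] [hh : TermFn h] : D0 fun v => Agree T (f v) (g v) (h v) := by
  have : D0 fun w : Fin 3 → M.carrier => Agree T (w 0) (w 1) (w 2) := by
    unfold Agree; infer_instance
  exact this.comp (σ := ![f, g, h]) fun i => by fin_cases i <;> assumption

/-- `pr v s` is a guess: `s` is `v`, or a stage after `v` where a number up to `v` is enumerated
(or the first such stage). -/
def Guess (T : M.sets) (v s : M.carrier) : Prop :=
  s = v ∨ v < s ∧ ∀ t < s, v < t → ¬ Agree T (v + 1) t s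

instance (T : M.sets) {n : ℕ} {f g : (Fin n → M.carrier) → M.carrier}
    [hf : TermFn f] [hg : TermFn g] : D0 fun v => Guess T (f v) (g v) :=
  D0.comp₂ (by unfold Guess; infer_instance) f g

/-- The set of guesses. -/
def guessSet (T : M.sets) : M.sets :=
  setOfD0 fun x => ∃ v < x + 1, ∃ s < x + 1, x = pr v s ∧ Guess T v s

theorem mem_guessSet {T : M.sets} {x : M.carrier} :
    x ∈ (guessSet T : Set M.carrier) ↔ ∃ v s, x = pr v s ∧ Guess T v s := by
  simp only [guessSet, mem_setOfD0]
  constructor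
  · rintro ⟨v, -, s, -, h⟩; exact ⟨v, s, h⟩
  · rintro ⟨v, s, rfl, h⟩
    exact ⟨v, BasicModel.lt_add_one.2 (le_pr_left _ _), s,
      BasicModel.lt_add_one.2 (le_pr_right _ _), rfl, h⟩

/-- A guess lies below all guesses that are made after it has been refuted. -/
def guessLe (T : M.sets) : M.sets :=
  setOfD0 fun z => ∃ x < z + 1, ∃ y < z + 1, z = pr x y ∧ x ∈ (guessSet T : Set M.carrier) ∧
    y ∈ (guessSet T : Set M.carrier) ∧ (x = y ∨ ∃ v < x + 1, ∃ s < x + 1, ∃ w < y + 1,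
      ∃ t < y + 1, x = pr v s ∧ y = pr w t ∧ s < t ∧ ¬ Agree T v s t)

theorem mem_guessLe {T : M.sets} {z : M.carrier} : z ∈ (guessLe T : Set M.carrier) ↔
    ∃ x y, z = pr x y ∧ x ∈ (guessSet T : Set M.carrier) ∧ y ∈ (guessSet T : Set M.carrier) ∧
      (x = y ∨ ∃ v s w t, x = pr v s ∧ y = pr w t ∧ s < t ∧ ¬ Agree T v s t) := by
  simp only [guessLe, mem_setOfD0]
  constructor
  · rintro ⟨x, -, y, -, rfl, hx, hy, h⟩
    refine ⟨x, y, rfl, hx, hy, h.imp id ?_⟩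
    rintro ⟨v, -, s, -, w, -, t, -, h⟩
    exact ⟨v, s, w, t, h⟩
  · rintro ⟨x, y, rfl, hx, hy, h⟩
    refine ⟨x, BasicModel.lt_add_one.2 (le_pr_left _ _), y,
      BasicModel.lt_add_one.2 (le_pr_right _ _), rfl, hx, hy, h.imp id ?_⟩
    rintro ⟨v, s, w, t, rfl, rfl, h'⟩
    exact ⟨v, BasicModel.lt_add_one.2 (le_pr_left _ _), s,
      BasicModel.lt_add_one.2 (le_pr_right _ _), w, BasicModel.lt_add_one.2 (le_pr_left _ _), t,
      BasicModel.lt_add_one.2 (le_pr_right _ _), rfl, rfl, h'⟩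

theorem pr_mem_guessLe {T : M.sets} {v s w t : M.carrier} :
    pr (pr v s) (pr w t) ∈ (guessLe T : Set M.carrier) ↔ Guess T v s ∧ Guess T w t ∧
      (v = w ∧ s = t ∨ s < t ∧ ¬ Agree T v s t) := by
  have hQ (v s : M.carrier) : pr v s ∈ (guessSet T : Set M.carrier) ↔ Guess T v s := by
    rw [mem_guessSet]
    constructor
    · rintro ⟨v', s', h, h'⟩
      obtain ⟨rfl, rfl⟩ := pr_inj h
      exact h'
    · exact fun h => ⟨v, s, rfl, h⟩
  rw [mem_guessLe]
  constructor
  · rintro ⟨x, y, h, hx, hy, h'⟩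
    obtain ⟨rfl, rfl⟩ := pr_inj h
    refine ⟨(hQ _ _).1 hx, (hQ _ _).1 hy, ?_⟩
    rcases h' with h' | ⟨v', s', w', t', h1, h2, h3⟩
    · exact .inl (pr_inj h')
    · obtain ⟨rfl, rfl⟩ := pr_inj h1
      obtain ⟨rfl, rfl⟩ := pr_inj h2
      exact .inr h3
  · rintro ⟨hx, hy, h⟩
    refine ⟨_, _, rfl, (hQ _ _).2 hx, (hQ _ _).2 hy, ?_⟩
    rcases h with ⟨h1, h2⟩ | h
    · exact .inl (by rw [h1, h2])
    · exact .inr ⟨v, s, w, t, rfl, rfl, h⟩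

/-- The stages of `T` increase. -/
def Increasing (T : M.sets) : Prop :=
  ∀ v s t, s ≤ t → pr v s ∈ (T : Set M.carrier) → pr v t ∈ (T : Set M.carrier)

/-- Stages only grow, so agreement at the ends of an interval of stages forces agreement throughout.
-/
theorem Agree.mono {T : M.sets} (hT : Increasing T) {v s t s' t' : M.carrier} (h : Agree T v s t)
    (h1 : s ≤ s') (h2 : s' ≤ t') (h3 : t' ≤ t) : Agree T v s' t' := fun u hu =>
  ⟨hT _ _ _ h2, fun h' => hT _ _ _ h1 ((h u hu).2 (hT _ _ _ h3 h'))⟩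

theorem isQO_guessLe {T : M.sets} (hT : Increasing T) :
    IsQO (guessSet T : Set M.carrier) (guessLe T : Set M.carrier) := by
  refine ⟨fun z hz => ?_, fun x hx => ?_, fun x y z ⟨h, h'⟩ => ?_⟩
  · obtain ⟨x, y, h, hx, hy, -⟩ := mem_guessLe.1 hz
    exact ⟨x, y, h, hx, hy⟩
  · exact mem_guessLe.2 ⟨x, x, rfl, hx, hx, .inl rfl⟩
  · have key : ∀ x y : M.carrier, pr x y ∈ (guessLe T : Set M.carrier) →
        (∃ v s, x = pr v s) ∧ ∃ v s, y = pr v s := fun x y h => by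
      obtain ⟨x', y', h, hx, hy, -⟩ := mem_guessLe.1 h
      obtain ⟨rfl, rfl⟩ := pr_inj h
      obtain ⟨v, s, h1, -⟩ := mem_guessSet.1 hx
      obtain ⟨w, t, h2, -⟩ := mem_guessSet.1 hy
      exact ⟨⟨v, s, h1⟩, w, t, h2⟩
    obtain ⟨⟨v, s, rfl⟩, w, t, rfl⟩ := key _ _ h
    obtain ⟨-, p, q, rfl⟩ := key _ _ h'
    rw [pr_mem_guessLe] at h h' ⊢
    refine ⟨h.1, h'.2.1, ?_⟩
    rcases h.2.2 with ⟨rfl, rfl⟩ | ⟨h1, h2⟩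
    · exact h'.2.2
    · rcases h'.2.2 with ⟨rfl, rfl⟩ | ⟨h3, -⟩
      · exact .inr ⟨h1, h2⟩
      -- A refuted guess remains refuted at all later stages.
      · exact .inr ⟨h1.trans h3, fun h => h2 (h.mono hT le_rfl h1.le h3.le)⟩

/-- `pr v s` is one of the guesses that are made at the stage `n`. -/
def Current (T : M.sets) (n v s : M.carrier) : Prop :=
  Guess T v s ∧ v ≤ n ∧ s ≤ n ∧ (s = v ∧ n = v ∨ v < s ∧ Agree T (v + 1) s n)

instance (T : M.sets) {n : ℕ} {f g h : (Fin n → M.carrier) → M.carrier}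
    [hf : TermFn f] [hg : TermFn g] [hh : TermFn h] :
    D0 fun v => Current T (f v) (g v) (h v) := by
  have : D0 fun w : Fin 3 → M.carrier => Current T (w 0) (w 1) (w 2) := by
    unfold Current; infer_instance
  exact this.comp (σ := ![f, g, h]) fun i => by fin_cases i <;> assumption

/-- For `v < n`, the least stage after `v` that agrees with stage `n` on the numbers up to `v`
works. -/
theorem exists_current (T : M.sets) {n v : M.carrier} (h : v ≤ n) : ∃ s, Current T n v s := by
  rcases h.lt_or_eq with h | rfl
  · obtain ⟨s, ⟨hs, hs', hs''⟩, hl⟩ := exists_least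
      (fun s => v < s ∧ s ≤ n ∧ Agree T (v + 1) s n) ⟨n, h, le_rfl, fun _ _ => Iff.rfl⟩
    refine ⟨s, .inr ⟨hs, fun t ht hv ha => hl t ht ⟨hv, ht.le.trans hs', fun u hu =>
      (ha u hu).trans (hs'' u hu)⟩⟩, h.le, hs', .inr ⟨hs, hs''⟩⟩
  · exact ⟨v, .inl rfl, le_rfl, le_rfl, .inl ⟨rfl, rfl⟩⟩

/-- Take the least `v < m` that enters `T` between the stages `m` and `n`, or `v = m` if there is
none. Nothing below `v` changes in between, so no guess current at `n` refutes the guess for `v`.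
That guess is not current at `n` either: `v` itself has entered, or the guess is `(m, m)`, which is
current at stage `m` only. This is why `Guess` and `Current` watch the numbers up to `v`, but the
order only those below `v`. -/
theorem current_bad {T : M.sets} (hT : Increasing T) {m n : M.carrier} (hmn : m < n) :
    ∃ v s, Current T m v s ∧ ∀ w t, Current T n w t →
      pr (pr v s) (pr w t) ∉ (guessLe T : Set M.carrier) := by
  obtain ⟨v, hvm, hv, hv'⟩ : ∃ v ≤ m, Agree T v m n ∧
      (v = m ∨ pr v m ∉ (T : Set M.carrier) ∧ pr v n ∈ (T : Set M.carrier)) := by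
    obtain ⟨v, hv, hl⟩ := exists_least (fun v => v = m ∨ v ≤ m ∧ pr v m ∉ (T : Set M.carrier) ∧
      pr v n ∈ (T : Set M.carrier)) ⟨m, .inl rfl⟩
    have hvm : v ≤ m := hv.elim (fun h => h.le) (fun h => h.1)
    refine ⟨v, hvm, fun u hu => ⟨hT _ _ _ hmn.le, fun h => ?_⟩, hv.imp id fun h => h.2⟩
    by_contra h'
    exact hl u hu (.inr ⟨hu.le.trans hvm, h', h⟩)
  obtain ⟨s, hs⟩ := exists_current T hvm
  refine ⟨v, s, hs, fun w t ht hle => ?_⟩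
  rcases (pr_mem_guessLe.1 hle).2.2 with ⟨rfl, rfl⟩ | ⟨h1, h2⟩
  · rcases hs.2.2.2 with ⟨rfl, rfl⟩ | ⟨h3, h4⟩
    · rcases ht.2.2.2 with ⟨-, rfl⟩ | ⟨h5, -⟩
      · exact lt_irrefl _ hmn
      · exact lt_irrefl _ h5
    · rcases hv' with rfl | ⟨h5, h6⟩
      · exact absurd hs.2.2.1 h3.not_ge
      · rcases ht.2.2.2 with ⟨rfl, rfl⟩ | ⟨-, h7⟩
        · exact lt_irrefl _ h3
        · exact h5 ((h4 v (lt_add_one v)).1 ((h7 v (lt_add_one v)).2 h6))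
  · refine h2 fun u hu => ⟨hT _ _ _ h1.le, fun h => ?_⟩
    have h3 : pr u m ∈ (T : Set M.carrier) := (hv u hu).2 (hT _ _ _ ht.2.2.1 h)
    rcases hs.2.2.2 with ⟨rfl, rfl⟩ | ⟨-, h4⟩
    · exact h3
    · exact (h4 u (hu.trans (lt_add_one v))).2 h3

/-- The set of guesses that are made at the stage `n` has a code. -/
theorem exists_current_code (T : M.sets) (n : M.carrier) :
    ∃ c, IsCode c ∧ ∀ i, MemC i c ↔ ∃ v s, i = pr v s ∧ Current T n v s := by
  obtain ⟨c, hc, h⟩ := exists_code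
    (setOfD0 fun i => ∃ v < i + 1, ∃ s < i + 1, i = pr v s ∧ Current T n v s) (pr n n + 1)
  refine ⟨c, hc, fun i => (h i).trans ⟨?_, ?_⟩⟩
  · rintro ⟨-, v, -, s, -, h⟩; exact ⟨v, s, h⟩
  · rintro ⟨v, s, rfl, h⟩
    exact ⟨BasicModel.lt_add_one.2 (pr_le_pr h.2.1 h.2.2.1), v,
      BasicModel.lt_add_one.2 (le_pr_left _ _), s, BasicModel.lt_add_one.2 (le_pr_right _ _),
      rfl, h⟩

theorem exists_current_seq (T : M.sets) : ∃ F : M.sets,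
    (∀ z ∈ (F : Set M.carrier), ∃ n c, z = pr n c) ∧ ∀ n c, pr n c ∈ (F : Set M.carrier) ↔
      IsCode c ∧ ∀ i, MemC i c ↔ ∃ v s, i = pr v s ∧ Current T n v s := by
  -- The two inclusions are written with separate bounds: members of `c` lie below `c`, and both
  -- components of a guess current at `n` are at most `n`.
  refine ⟨setOfD0 fun z => ∃ n < z + 1, ∃ c < z + 1, z = pr n c ∧ IsCode c ∧
    (∀ i < c, MemC i c → ∃ v < i + 1, ∃ s < i + 1, i = pr v s ∧ Current T n v s) ∧
    ∀ v < n + 1, ∀ s < n + 1, Current T n v s → MemC (pr v s) c,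
    fun z ⟨n, _, c, _, h, _⟩ => ⟨n, c, h⟩, fun n c => ?_⟩
  rw [mem_setOfD0]
  constructor
  · rintro ⟨n', -, c', -, h, hc, h1, h2⟩
    obtain ⟨rfl, rfl⟩ := pr_inj h
    refine ⟨hc, fun i => ⟨fun hi => ?_, ?_⟩⟩
    · obtain ⟨v, -, s, -, h⟩ := h1 i hi.lt hi
      exact ⟨v, s, h⟩
    · rintro ⟨v, s, rfl, h⟩
      exact h2 v (BasicModel.lt_add_one.2 h.2.1) s (BasicModel.lt_add_one.2 h.2.2.1) h
  · rintro ⟨hc, h⟩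
    refine ⟨n, BasicModel.lt_add_one.2 (le_pr_left _ _), c,
      BasicModel.lt_add_one.2 (le_pr_right _ _), rfl, hc, fun i _ hi => ?_, fun v _ s _ hv =>
      (h _).2 ⟨v, s, rfl, hv⟩⟩
    obtain ⟨v, s, rfl, hv⟩ := (h i).1 hi
    exact ⟨v, BasicModel.lt_add_one.2 (le_pr_left _ _), s,
      BasicModel.lt_add_one.2 (le_pr_right _ _), rfl, hv⟩

/-- The guesses are not well-quasi-ordered, if finite powersets of wqos are. -/
theorem not_isWqo_guessLe (hflat : M.Satisfies flatWQO) {T : M.sets} (hT : Increasing T) :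
    ¬ IsWqo (guessSet T : Set M.carrier) (guessLe T : Set M.carrier) := by
  intro hQ
  obtain ⟨P, hP, L, hL, hPow, hFlat, -, hW⟩ :=
    satisfies_flatWQO.1 hflat _ (guessSet T).2 _ (guessLe T).2 hQ
  obtain ⟨F, hF₀, hF⟩ := exists_current_seq T
  have hF' : IsSeq (F : Set M.carrier) P := by
    refine ⟨fun z hz => ?_, fun n => ?_, fun n c d ⟨hc, hd⟩ => ?_⟩
    · obtain ⟨n, c, rfl⟩ := hF₀ z hz
      obtain ⟨hc, h⟩ := (hF n c).1 hz
      refine ⟨n, c, rfl, (hPow c).2 ⟨hc, fun i hi => ?_⟩⟩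
      obtain ⟨v, s, rfl, hs⟩ := (h i).1 hi
      exact mem_guessSet.2 ⟨v, s, rfl, hs.1⟩
    · obtain ⟨c, hc⟩ := exists_current_code T n
      exact ⟨c, (hF n c).2 hc⟩
    · rw [hF] at hc hd
      exact isCode_unique hc.1 hd.1 fun i => (hc.2 i).trans (hd.2 i).symm
  obtain ⟨m, n, c, d, hmn, hc, hd, hcd⟩ := hW F F.2 hF'
  rw [hF] at hc hd
  obtain ⟨c', d', h, -, -, hcd⟩ := (hFlat _).1 hcd
  obtain ⟨rfl, rfl⟩ := pr_inj h
  obtain ⟨v, s, hs, hbad⟩ := current_bad hT hmn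
  obtain ⟨y, hy, hy'⟩ := hcd _ ((hc.2 _).2 ⟨v, s, rfl, hs⟩)
  obtain ⟨w, t, rfl, ht⟩ := (hd.2 _).1 hy
  exact hbad w t ht hy'

/-- `Σ⁰₁` comprehension follows from the statement about finite powersets of wqos. -/
theorem sigma_mem_sets_of_flatWQO (hflat : M.Satisfies flatWQO)
    (P : M.carrier → M.carrier → Prop) (hP : D0 fun v : Fin 2 → M.carrier => P (v 0) (v 1)) :
    {x | ∃ a, P a x} ∈ M.sets := by
  have (n : ℕ) (f g : (Fin n → M.carrier) → M.carrier) [TermFn f] [TermFn g] :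
    D0 fun v => P (f v) (g v) := hP.comp₂ f g
  -- Stage `s` contains those `v` that have a witness `u ≤ s`.
  let T : M.sets := setOfD0 fun z => ∃ v < z + 1, ∃ s < z + 1, z = pr v s ∧ ∃ u < s + 1, P u v
  have hTmem : ∀ v s, pr v s ∈ (T : Set M.carrier) ↔ ∃ u ≤ s, P u v := fun v s => by
    simp only [T, mem_setOfD0]
    constructor
    · rintro ⟨v', -, s', -, h, u, hu, h'⟩
      obtain ⟨rfl, rfl⟩ := pr_inj h
      exact ⟨u, BasicModel.lt_add_one.1 hu, h'⟩
    · rintro ⟨u, hu, h⟩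
      exact ⟨v, BasicModel.lt_add_one.2 (le_pr_left _ _), s,
        BasicModel.lt_add_one.2 (le_pr_right _ _), rfl, u, BasicModel.lt_add_one.2 hu, h⟩
  have hT : Increasing T := fun v s t hst h => by
    obtain ⟨u, hu, h⟩ := (hTmem _ _).1 h
    exact (hTmem _ _).2 ⟨u, hu.trans hst, h⟩
  have hW := not_isWqo_guessLe hflat hT
  simp only [IsWqo, isQO_guessLe hT, true_and] at hW
  push Not at hW
  obtain ⟨F, hFs, hF, hbad⟩ := hW
  lift F to M.sets using hFs
  have hx : ∀ i, ∃ v s, pr i (pr v s) ∈ (F : Set M.carrier) ∧ Guess T v s := fun i => by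
    obtain ⟨x, hx⟩ := hF.2.1 i
    obtain ⟨i', x', h, h'⟩ := hF.1 _ hx
    obtain ⟨rfl, rfl⟩ := pr_inj h
    obtain ⟨v, s, rfl, hvs⟩ := mem_guessSet.1 h'
    exact ⟨v, s, hx, hvs⟩
  choose v s hvs hg using hx
  have hvs_le : ∀ i, v i ≤ s i := fun i => (hg i).elim (fun h => h.ge) (fun h => h.1.le)
  have hbad' : ∀ i j, i < j → ¬ (v i = v j ∧ s i = s j) ∧
      (s i < s j → Agree T (v i) (s i) (s j)) := fun i j hij => by
    have := hbad i j _ _ hij (hvs i) (hvs j)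
    rw [pr_mem_guessLe] at this
    grind
  have hunb : ∀ i₀ V, ∃ j, i₀ < j ∧ V ≤ pr (v j) (s j) :=
    exists_le_of_injective F (fun i => pr (v i) (s i))
      (fun i y => ⟨fun h => hF.2.2 i _ _ ⟨h, hvs i⟩, fun h => h ▸ hvs i⟩)
      (fun i j hij h => (hbad' i j hij).1 (pr_inj h))
  -- As `v j ≤ s j`, a large code `pr (v j) (s j)` means a late stage `s j`. The guess `i` is
  -- unrefuted at some stage `s j` after `u`, hence at `u`.
  have correct : ∀ i u, s i ≤ u → Agree T (v i) (s i) u := fun i u hu => by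
    obtain ⟨j, hij, hj⟩ := hunb i (pr u u + 1)
    have huj : u < s j := by
      by_contra! h
      exact absurd (hj.trans (pr_le_pr ((hvs_le j).trans h) h)) (lt_add_one _).not_ge
    exact ((hbad' i j hij).2 (hu.trans_lt huj)).mono hT le_rfl hu huj.le
  -- Otherwise all changes on numbers up to `V` happen by stage `B`, so no guess has a stage beyond
  -- `max B (V + 1)`. The term `V + 1` ensures that this comparison stage comes after `v j`. All
  -- codes of guesses would then be bounded.
  have unb : ∀ V, ∃ i, V < v i := fun V => by
    by_contra! hc
    obtain ⟨B, hB⟩ := exists_bound T (V + 1)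
    obtain ⟨j, -, hj⟩ := hunb 0 (pr V (max B (V + 1)) + 1)
    have hs : s j ≤ max B (V + 1) := by
      by_contra! h
      rcases hg j with h' | ⟨-, h'⟩
      · have := h.trans_le (h'.le.trans (hc j))
        exact absurd ((le_max_right B (V + 1)).trans this.le) (lt_add_one V).not_ge
      · refine h' _ h ((BasicModel.lt_add_one.2 (hc j)).trans_le (le_max_right _ _))
          fun u hu => ⟨hT _ _ _ h.le, fun hu' => ?_⟩
        obtain ⟨t, ht, ht'⟩ := hB u (hu.trans_le (by gcongr; exact hc j)) ⟨_, hu'⟩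
        exact hT _ _ _ (ht.le.trans (le_max_left _ _)) ht'
    exact absurd (hj.trans (pr_le_pr (hc j) hs)) (lt_add_one _).not_ge
  -- The Π⁰₁ form: every guess of the sequence that speaks about `x` has `x` in its stage. It
  -- implies the Σ⁰₁ form because some guess does speak about `x`, and follows from it because all
  -- guesses are correct.
  refine delta_mem_sets P (fun a x => ∀ i < a + 1, ∀ w < a + 1, ∀ t < a + 1, a = pr i (pr w t) →
    a ∈ (F : Set M.carrier) → x < w → pr x t ∈ (T : Set M.carrier)) fun x => ⟨?_, fun h => ?_⟩
  · rintro ⟨a, ha⟩ z i - w - t - rfl hz hxw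
    have := pr_inj (hF.2.2 i _ _ ⟨hz, hvs i⟩)
    obtain ⟨rfl, rfl⟩ := this
    exact ((correct i (max (s i) a) (le_max_left _ _)) x hxw).2
      ((hTmem _ _).2 ⟨a, le_max_right _ _, ha⟩)
  · obtain ⟨i, hi⟩ := unb x
    obtain ⟨h1, h2, h3⟩ := triple_bounds i (v i) (s i)
    have := h _ i h1 _ h2 _ h3 rfl (hvs i) hi
    obtain ⟨u, -, hu⟩ := (hTmem _ _).1 this
    exact ⟨u, hu⟩

end Reversal

/-! ## Arithmetical definability -/

section Arithmetical

variable {M : Model.{u}}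

theorem D0.comp₃ [hM : BasicModel M] {P : M.carrier → M.carrier → M.carrier → Prop}
    (hP : D0 fun v : Fin 3 → M.carrier => P (v 0) (v 1) (v 2))
    {n : ℕ} (f g h : (Fin n → M.carrier) → M.carrier) [hf : TermFn f] [hg : TermFn g]
    [hh : TermFn h] : D0 fun v => P (f v) (g v) (h v) :=
  hP.comp (σ := ![f, g, h]) fun i => by fin_cases i <;> assumption

/-- All but one of the arguments of a bounded relation can be coded into one number. -/
theorem D0.exists_binary [hM : BasicModel M] {n : ℕ}
    {P : M.carrier → (Fin n → M.carrier) → Prop}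
    (hP : D0 fun w : Fin (n + 1) → M.carrier => P (w 0) fun i => w i.succ) :
    ∃ (P' : M.carrier → M.carrier → Prop) (e : (Fin n → M.carrier) → M.carrier),
      D0 (fun v : Fin 2 → M.carrier => P' (v 0) (v 1)) ∧ TermFn e ∧ ∀ a v, P a v ↔ P' a (e v) := by
  induction n with
  | zero =>
    refine ⟨fun a x => P a fun _ => x, fun _ => 0, ?_, inferInstance, fun a v => ?_⟩
    · exact hP.comp (σ := Fin.cons (fun v => v 0) fun _ v => v 1)
        (Fin.cases (.var 0) fun _ => .var 1)
    · rw [Subsingleton.elim v]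
  | succ n ih =>
    cases n with
    | zero =>
      refine ⟨fun a x => P a fun _ => x, fun v => v 0, ?_, inferInstance, fun a v => ?_⟩
      · exact hP.comp (σ := Fin.cons (fun v => v 0) fun _ v => v 1)
          (Fin.cases (.var 0) fun _ => .var 1)
      · have hv : v = fun _ => v 0 := funext fun i => by rw [Fin.fin_one_eq_zero i]
        exact iff_of_eq (congrArg (P a) hv)
    | succ n =>
      -- The first two arguments are merged into one pair, which is decoded by bounded quantifiers.
      obtain ⟨P', e, hP', he, h⟩ := ih (P := fun a w => ∃ x < w 0 + 1, ∃ y < w 0 + 1,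
        w 0 = pr x y ∧ P a (Fin.cons x (Fin.cons y fun i => w i.succ))) (by
          have : D0 fun w : Fin (n + 1 + 1 + 1 + 1) → M.carrier =>
              P (w 2) (Fin.cons (w 1) (Fin.cons (w 0) fun i => w i.succ.succ.succ.succ)) := by
            convert hP.comp (σ := Fin.cons (fun w : Fin (n + 1 + 1 + 1 + 1) → M.carrier => w 2)
              (Fin.cons (fun w => w 1) (Fin.cons (fun w => w 0)
                fun i w => w i.succ.succ.succ.succ)))
              (Fin.cases (.var 2) (Fin.cases (.var 1) (Fin.cases (.var 0) fun _ => .var _)))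
              using 3 with w
            · rfl
            · funext i
              exact Fin.cases rfl (Fin.cases rfl fun _ => rfl) i
          refine @D0.exLT _ _ _ _ _ inferInstance ?_
          refine @D0.exLT _ _ _ _ _ inferInstance ?_
          exact .and inferInstance this)
      refine ⟨P', fun v => e (Fin.cons (pr (v 0) (v 1)) fun i => v i.succ.succ), hP', ?_,
        fun a v => ?_⟩
      · convert he.comp (σ := Fin.cons (fun v : Fin (n + 1 + 1) → M.carrier => pr (v 0) (v 1))
          fun i v => v i.succ.succ) (Fin.cases
            (show TermFn fun v : Fin (n + 1 + 1) → M.carrier => pr (v 0) (v 1) from inferInstance)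
            fun _ => .var _) using 2 with v
        congr 1
        funext i
        exact Fin.cases rfl (fun _ => rfl) i
      · rw [← h]
        simp only [Fin.cons_zero, Fin.cons_succ]
        have hv : v = Fin.cons (v 0) (Fin.cons (v 1) fun i => v i.succ.succ) := by
          funext i
          exact Fin.cases rfl (Fin.cases rfl fun _ => rfl) i
        constructor
        · intro hP
          exact ⟨v 0, BasicModel.lt_add_one.2 (le_pr_left _ _), v 1,
            BasicModel.lt_add_one.2 (le_pr_right _ _), rfl, by rwa [← hv]⟩
        · rintro ⟨x, -, y, -, hxy, hP⟩
          obtain ⟨rfl, rfl⟩ := pr_inj hxy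
          rwa [hv]

variable [hM : ACAModel M]

/-- Once the arguments are coded into one number, the relation is membership of a term in a set
supplied by Σ⁰₁ comprehension. So in models of `ACA₀` the class `D0` contains all arithmetical
relations, and induction, bounding and least elements hold for them. -/
instance {n : ℕ} {P : M.carrier → (Fin n → M.carrier) → Prop}
    [h : D0 (fun w : Fin (n + 1) → M.carrier => P (w 0) (fun i => w i.succ))] :
    D0 fun v => ∃ a, P a v := by
  obtain ⟨P', e, hP', he, h⟩ := h.exists_binary
  convert D0.mem ⟨_, hM.sigma' P' hP'⟩ he using 2
  exact exists_congr fun a => h a _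

instance {n : ℕ} {P : M.carrier → (Fin n → M.carrier) → Prop}
    [h : D0 (fun w : Fin (n + 1) → M.carrier => P (w 0) (fun i => w i.succ))] :
    D0 fun v => ∀ a, P a v := by
  have : D0 fun w : Fin (n + 1) → M.carrier => ¬ P (w 0) (fun i => w i.succ) := .not h
  have : D0 fun v => ∃ a, ¬ P a v := inferInstance
  convert D0.not this using 2
  push Not; rfl

theorem termFn_val {n : ℕ} (t : Term n) : TermFn fun v => t.val M v := by
  induction t with
  | var i => exact .var i
  | zero => exact .const _
  | one => exact .const _
  | add s t h h' => exact .add h h'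
  | mul s t h h' => exact .mul h h'

theorem D0.of_isArithmetical {n m : ℕ} {φ : Formula n m} (hφ : φ.IsArithmetical)
    {V : Fin m → Set M.carrier} (hV : ∀ i, V i ∈ M.sets) : D0 fun v => φ.Sat M v V := by
  induction φ with
  | eq s t => exact .eq (termFn_val s) (termFn_val t)
  | lt s t => exact .lt (termFn_val s) (termFn_val t)
  | mem t X => exact .mem ⟨V X, hV X⟩ (termFn_val t)
  | neg φ h => exact .not (h hφ hV)
  | and φ ψ h h' => exact .and (h hφ.1 hV) (h' hφ.2 hV)
  | or φ ψ h h' =>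
    have := h hφ.1 hV
    have := h' hφ.2 hV
    exact inferInstanceAs (D0 fun v => φ.Sat M v V ∨ ψ.Sat M v V)
  | imp φ ψ h h' =>
    have := h hφ.1 hV
    have := h' hφ.2 hV
    exact inferInstanceAs (D0 fun v => φ.Sat M v V → ψ.Sat M v V)
  | @all n m φ h =>
    have : D0 fun w : Fin (n + 1) → M.carrier =>
        φ.Sat M (Fin.cons (w 0) fun i => w i.succ : Fin (n + 1) → M.carrier) V := by
      convert h hφ hV using 2 with w
      exact iff_of_eq (congrArg (φ.Sat M · V) (Fin.cons_self_tail w))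
    exact inferInstanceAs (D0 fun v => ∀ a, φ.Sat M (Fin.cons a v : Fin (n + 1) → M.carrier) V)
  | @ex n m φ h =>
    have : D0 fun w : Fin (n + 1) → M.carrier =>
        φ.Sat M (Fin.cons (w 0) fun i => w i.succ : Fin (n + 1) → M.carrier) V := by
      convert h hφ hV using 2 with w
      exact iff_of_eq (congrArg (φ.Sat M · V) (Fin.cons_self_tail w))
    exact inferInstanceAs (D0 fun v => ∃ a, φ.Sat M (Fin.cons a v : Fin (n + 1) → M.carrier) V)
  | allSet => exact hφ.elim
  | exSet => exact hφ.elim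

theorem satisfies_aca : ∀ ψ ∈ ACA₀, M.Satisfies ψ := by
  rintro ψ ((h | rfl) | ⟨n, m, φ, hφ, rfl⟩)
  · exact (basicModel_iff M).1 inferInstance ψ h
  · change ∀ A ∈ M.sets, (0 : M.carrier) ∈ A ∧ (∀ a ∈ A, a + 1 ∈ A) → ∀ a, a ∈ A
    intro A hA ⟨h0, hs⟩ a
    lift A to M.sets using hA
    exact d0_induction (fun a => a ∈ (A : Set M.carrier)) h0 hs a
  · rw [satisfies_comprehensionFor]
    intro V hV v
    have h : D0 fun w : Fin 1 → M.carrier =>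
        φ.Sat M (Fin.cons (w 0) v : Fin (n + 1) → M.carrier) V := by
      convert (D0.of_isArithmetical hφ hV).comp (σ := Fin.cons (fun w : Fin 1 → M.carrier => w 0)
        fun i _ => v i) (Fin.cases (.var 0) fun _ => .const _) using 3 with w
      funext i
      exact Fin.cases rfl (fun _ => rfl) i
    exact (setOfD0 (fun a => φ.Sat M (Fin.cons a v : Fin (n + 1) → M.carrier) V) h).2

end Arithmetical

/-! ## Homogeneous sequences -/

section Forward

variable {M : Model.{u}} [hM : ACAModel M]

/-- `n'` is the least number that may follow `n` at position `k`. -/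
def Next (W I : M.sets) (k n n' : M.carrier) : Prop :=
  (pr k (pr n n') ∈ (W : Set M.carrier) ∧ pr (k + 1) n' ∈ (I : Set M.carrier)) ∧
    ∀ m < n', ¬ (pr k (pr n m) ∈ (W : Set M.carrier) ∧ pr (k + 1) m ∈ (I : Set M.carrier))

instance (W I : M.sets) {n : ℕ} {f g h : (Fin n → M.carrier) → M.carrier} [TermFn f] [TermFn g]
    [TermFn h] : D0 fun v => Next W I (f v) (g v) (h v) :=
  D0.comp₃ (by unfold Next; infer_instance) f g h

/-- `c` codes an initial part of the computation of the sequence that starts with `a`. -/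
def Trace (W I : M.sets) (a c : M.carrier) : Prop :=
  ∀ i z, MemC (pr i z) c → i = 0 ∧ z = a ∨
    ∃ i' z', i = i' + 1 ∧ Next W I i' z' z ∧ MemC (pr i' z') c

instance (W I : M.sets) {n : ℕ} {f g : (Fin n → M.carrier) → M.carrier} [TermFn f] [TermFn g] :
    D0 fun v => Trace W I (f v) (g v) :=
  D0.comp₂ (by unfold Trace; infer_instance) f g

/-- `y` is reached at position `j`. -/
def Reach (W I : M.sets) (a j y : M.carrier) : Prop := ∃ c, Trace W I a c ∧ MemC (pr j y) c

instance (W I : M.sets) {n : ℕ} {f g h : (Fin n → M.carrier) → M.carrier} [TermFn f] [TermFn g]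
    [TermFn h] : D0 fun v => Reach W I (f v) (g v) (h v) :=
  D0.comp₃ (by unfold Reach; infer_instance) f g h

theorem reach_zero {W I : M.sets} {a : M.carrier} :
    Reach W I a 0 a ∧ ∀ y, Reach W I a 0 y → y = a := by
  constructor
  · obtain ⟨c, -, hc⟩ := exists_code (setOfD0 fun x => x = pr 0 a) (pr 0 a + 1)
    refine ⟨c, fun i z h => .inl (pr_inj ((hc _).1 h).2), (hc _).2 ⟨lt_add_one _, rfl⟩⟩
  · rintro y ⟨c, hc, h⟩
    rcases hc _ _ h with ⟨-, h⟩ | ⟨i, z, h, -⟩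
    · exact h
    · exact absurd h (lt_of_lt_of_le zero_lt_one le_add_self).ne

theorem reach_pred {W I : M.sets} {a j y : M.carrier} (h : Reach W I a (j + 1) y) :
    ∃ z, Reach W I a j z ∧ Next W I j z y := by
  obtain ⟨c, hc, h⟩ := h
  rcases hc _ _ h with ⟨h, -⟩ | ⟨i, z, h, h', h''⟩
  · exact absurd h.symm (lt_of_lt_of_le zero_lt_one le_add_self).ne
  · obtain rfl := add_right_cancel h
    exact ⟨z, ⟨c, hc, h''⟩, h'⟩

theorem reach_succ {W I : M.sets} {a j y y' : M.carrier} (h : Reach W I a j y)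
    (h' : Next W I j y y') : Reach W I a (j + 1) y' := by
  obtain ⟨c, hc, h⟩ := h
  -- The new pair is added to the trace; the bound exceeds it and all members of `c`.
  obtain ⟨d, -, hd⟩ := exists_code (setOfD0 fun x => MemC x c ∨ x = pr (j + 1) y')
    (c + pr (j + 1) y' + 1)
  have hd' : ∀ x, MemC x d ↔ MemC x c ∨ x = pr (j + 1) y' := fun x =>
    (hd x).trans (and_iff_right_of_imp fun h => BasicModel.lt_add_one.2
      (h.elim (fun h => h.lt.le.trans le_self_add) (fun h => h.le.trans le_add_self)))
  refine ⟨d, fun i z hi => ?_, (hd' _).2 (.inr rfl)⟩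
  rcases (hd' _).1 hi with hi | hi
  · refine (hc i z hi).imp id ?_
    rintro ⟨i', z', h1, h2, h3⟩
    exact ⟨i', z', h1, h2, (hd' _).2 (.inl h3)⟩
  · obtain ⟨rfl, rfl⟩ := pr_inj hi
    exact .inr ⟨j, y, rfl, h', (hd' _).2 (.inl h)⟩

theorem next_unique {W I : M.sets} {k n x y : M.carrier} (hx : Next W I k n x)
    (hy : Next W I k n y) : x = y := by
  rcases lt_trichotomy x y with h | h | h
  · exact absurd hx.1 (hy.2 x h)
  · exact h
  · exact absurd hy.1 (hx.2 y h)

/-- Dependent choice for arithmetical relations. -/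
theorem exists_seq (W I : M.sets) (a : M.carrier) (h0 : pr 0 a ∈ (I : Set M.carrier))
    (h : ∀ k n, pr k n ∈ (I : Set M.carrier) →
      ∃ n', pr k (pr n n') ∈ (W : Set M.carrier) ∧ pr (k + 1) n' ∈ (I : Set M.carrier)) :
    ∃ (S : M.sets) (r : M.carrier → M.carrier), (∀ k n, pr k n ∈ (S : Set M.carrier) ↔ n = r k) ∧
      ∀ k, pr k (r k) ∈ (I : Set M.carrier) ∧
        pr k (pr (r k) (r (k + 1))) ∈ (W : Set M.carrier) := by
  have hnext : ∀ k n, pr k n ∈ (I : Set M.carrier) → ∃ n', Next W I k n n' := fun k n hk =>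
    exists_least (fun n' => pr k (pr n n') ∈ (W : Set M.carrier) ∧
      pr (k + 1) n' ∈ (I : Set M.carrier)) (h k n hk)
  -- Uniqueness is part of the induction, since the predecessor of a value at `j + 1` must be
  -- identified with the known value at `j`.
  have key : ∀ j, ∃ y, (Reach W I a j y ∧ pr j y ∈ (I : Set M.carrier)) ∧
      ∀ y', Reach W I a j y' → y' = y := fun j => by
    refine d0_induction (fun j => ∃ y, (Reach W I a j y ∧ pr j y ∈ (I : Set M.carrier)) ∧
      ∀ y', Reach W I a j y' → y' = y) ⟨a, ⟨reach_zero.1, h0⟩, reach_zero.2⟩ ?_ j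
    rintro j ⟨y, ⟨hy, hyI⟩, hu⟩
    obtain ⟨y', hy'⟩ := hnext j y hyI
    refine ⟨y', ⟨reach_succ hy hy', hy'.1.2⟩, fun y'' h => ?_⟩
    obtain ⟨z, hz, hz'⟩ := reach_pred h
    rw [hu z hz] at hz'
    exact next_unique hz' hy'
  choose r hr hu using key
  refine ⟨setOfD0 fun z => ∃ j y, z = pr j y ∧ Reach W I a j y, r, fun k n => ?_, fun k =>
    ⟨(hr k).2, ?_⟩⟩
  · rw [mem_setOfD0]
    constructor
    · rintro ⟨j, y, h, hy⟩
      obtain ⟨rfl, rfl⟩ := pr_inj h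
      exact hu _ _ hy
    · rintro rfl
      exact ⟨k, _, rfl, (hr k).1⟩
  · obtain ⟨z, hz, hz'⟩ := reach_pred (hr (k + 1)).1
    rw [hu _ _ hz] at hz'
    exact hz'.1.1

/-- The numbers `n` and `n'` have the same colours with the numbers below `k`. -/
def SameType (C : M.sets) (k n n' : M.carrier) : Prop :=
  ∀ m < k, ∀ x, pr (pr m n) x ∈ (C : Set M.carrier) ↔ pr (pr m n') x ∈ (C : Set M.carrier)

instance (C : M.sets) {n : ℕ} {f g h : (Fin n → M.carrier) → M.carrier} [TermFn f] [TermFn g]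
    [TermFn h] : D0 fun v => SameType C (f v) (g v) (h v) :=
  D0.comp₃ (by unfold SameType; infer_instance) f g h

theorem SameType.symm {C : M.sets} {k n n' : M.carrier} (h : SameType C k n n') :
    SameType C k n' n := fun m hm x => (h m hm x).symm

theorem SameType.trans {C : M.sets} {k n n' n'' : M.carrier} (h : SameType C k n n')
    (h' : SameType C k n' n'') : SameType C k n n'' := fun m hm x => (h m hm x).trans (h' m hm x)

theorem SameType.mono {C : M.sets} {k l n n' : M.carrier} (h : SameType C l n n') (hkl : k ≤ l) :
    SameType C k n n' := fun m hm x => h m (hm.trans_le hkl) x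

/-- Infinitely many numbers have the same colours as `n` with the numbers below `k`. -/
def InfType (C : M.sets) (k n : M.carrier) : Prop := ∀ b, ∃ n', b < n' ∧ SameType C k n n'

instance (C : M.sets) {n : ℕ} {f g : (Fin n → M.carrier) → M.carrier} [TermFn f] [TermFn g] :
    D0 fun v => InfType C (f v) (g v) :=
  D0.comp₂ (by unfold InfType; infer_instance) f g

variable {C : M.sets} (hC : ∀ m n, m < n → ∃ x, pr (pr m n) x ∈ (C : Set M.carrier))
  (hu : ∀ m n x y, pr (pr m n) x ∈ (C : Set M.carrier) → pr (pr m n) y ∈ (C : Set M.carrier) →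
    x = y)
  (hb : ∀ m, ∃ V, ∀ n x, pr (pr m n) x ∈ (C : Set M.carrier) → x < V)

include hC hu hb in
-- Pigeonhole: the numbers of the same type as `n` split into the fewer than `V` classes of their
-- colour with `k`. If each class were bounded, `exists_bound` would give a common bound,
-- contradicting that the type is infinite.
theorem InfType.exists_succ {k n : M.carrier} (h : InfType C k n) :
    ∃ n', SameType C k n n' ∧ InfType C (k + 1) n' := by
  by_contra! hc
  obtain ⟨V, hV⟩ := hb k
  let T : M.sets := setOfD0 fun z => ∃ x b, z = pr x b ∧ ∀ n', b < n' →
    ¬ (SameType C k n n' ∧ k < n' ∧ pr (pr k n') x ∈ (C : Set M.carrier))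
  have hT : ∀ x b, pr x b ∈ (T : Set M.carrier) ↔ ∀ n', b < n' →
      ¬ (SameType C k n n' ∧ k < n' ∧ pr (pr k n') x ∈ (C : Set M.carrier)) := fun x b => by
    simp only [T, mem_setOfD0]
    constructor
    · rintro ⟨x', b', h, h'⟩
      obtain ⟨rfl, rfl⟩ := pr_inj h
      exact h'
    · exact fun h => ⟨x, b, rfl, h⟩
  have hex : ∀ x, ∃ b, pr x b ∈ (T : Set M.carrier) := fun x => by
    by_contra! hn
    obtain ⟨n₀, -, hs, hk, hx⟩ : ∃ n', 0 < n' ∧ SameType C k n n' ∧ k < n' ∧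
        pr (pr k n') x ∈ (C : Set M.carrier) := by
      have := hn 0
      rw [hT] at this
      push Not at this
      exact this
    refine hc n₀ hs fun b => ?_
    have := hn b
    rw [hT] at this
    push Not at this
    obtain ⟨n₁, hb₁, hs₁, hk₁, hx₁⟩ := this
    refine ⟨n₁, hb₁, fun m hm y => ?_⟩
    rcases (BasicModel.lt_add_one.1 hm).lt_or_eq with hm | rfl
    · exact (hs.symm.trans hs₁) m hm y
    · exact ⟨fun hy => hu _ _ _ _ hy hx ▸ hx₁, fun hy => hu _ _ _ _ hy hx₁ ▸ hx⟩
  obtain ⟨B, hB⟩ := exists_bound T V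
  obtain ⟨n', hn', hs⟩ := h (max B k)
  obtain ⟨x, hx⟩ := hC k n' ((le_max_right _ _).trans_lt hn')
  obtain ⟨b, hb, hb'⟩ := hB x (hV _ _ hx) (hex x)
  exact (hT x b).1 hb' n' (hb.trans ((le_max_left _ _).trans_lt hn'))
    ⟨hs, (le_max_right _ _).trans_lt hn', hx⟩

include hC hu hb in
/-- A colouring of pairs, with finitely many colours for each smaller element, has a sequence along
which the colour depends on the smaller element only. -/
theorem exists_endHomogeneous : ∃ (S : M.sets) (h x : M.carrier → M.carrier),
    (∀ z ∈ (S : Set M.carrier), ∃ j y, z = pr j y) ∧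
    (∀ j y, pr j y ∈ (S : Set M.carrier) ↔ y = x j) ∧
    ∀ i j, i < j → pr (pr (h i) (h j)) (x i) ∈ (C : Set M.carrier) := by
  -- A path through the tree of types: `r k` stands for a type over the numbers below `k` that
  -- infinitely many numbers realize, and `r (k + 1)` extends this type.
  obtain ⟨S, r, hS, hr⟩ := exists_seq
    (setOfD0 fun z => ∃ k n n', z = pr k (pr n n') ∧ SameType C k n n')
    (setOfD0 fun z => ∃ k n, z = pr k n ∧ InfType C k n) 0
    ⟨0, 0, rfl, fun b => ⟨b + 1, lt_add_one b, fun m hm => absurd hm (not_lt_zero' m)⟩⟩ (by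
      rintro k n ⟨k', n', h, h'⟩
      obtain ⟨rfl, rfl⟩ := pr_inj h
      obtain ⟨n', h1, h2⟩ := h'.exists_succ hC hu hb
      exact ⟨n', ⟨k, n, n', rfl, h1⟩, _, _, rfl, h2⟩)
  have hrI : ∀ k, InfType C k (r k) := fun k => by
    obtain ⟨k', n', h, h'⟩ := (hr k).1
    obtain ⟨rfl, rfl⟩ := pr_inj h
    exact h'
  have hrW : ∀ k, SameType C k (r k) (r (k + 1)) := fun k => by
    obtain ⟨k', n', n'', e, h'⟩ := (hr k).2
    rw [pr_inj_iff, pr_inj_iff] at e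
    rwa [← e.1, ← e.2.1, ← e.2.2] at h'
  have hrr : ∀ k l, k ≤ l → SameType C k (r k) (r l) := fun k l hkl => by
    obtain ⟨d, rfl⟩ := exists_add_of_le hkl
    -- `r` is a function outside the model, so the induction formula refers to it through its graph
    -- `S`.
    refine (d0_induction
      (fun d => ∀ y, pr (k + d) y ∈ (S : Set M.carrier) → SameType C k (r k) y)
      (fun y hy => ?_) (fun d hd y hy => ?_) d) _ ((hS _ _).2 rfl)
    · rw [add_zero, hS] at hy
      rw [hy]
      exact fun _ _ _ => Iff.rfl
    · rw [← add_assoc, hS] at hy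
      rw [hy]
      exact (hd _ ((hS _ _).2 rfl)).trans ((hrW _).mono le_self_add)
  -- The type at `m + 1` decides the colour of `m` along the path; `r (m + 1)` need not exceed `m`,
  -- so the colour is found at a larger number of the same type.
  have hg : ∀ m, ∃ x, pr (pr m (r (m + 1))) x ∈ (C : Set M.carrier) := fun m => by
    obtain ⟨n', hn', h⟩ := hrI (m + 1) m
    obtain ⟨x, hx⟩ := hC m n' hn'
    exact ⟨x, (h m (lt_add_one m) x).2 hx⟩
  choose g hg using hg
  -- Each `h (j + 1)` is larger than `h j` and realizes the path's type over the numbers up to `h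
  -- j`, so every `m ≤ h j` has its colour `g m` with `h (j + 1)`.
  obtain ⟨S', h, hS', hh⟩ := exists_seq
    (setOfD0 fun z => ∃ k n n', z = pr k (pr n n') ∧ n < n' ∧
      ∀ y, pr (n + 1) y ∈ (S : Set M.carrier) → SameType C (n + 1) y n')
    (setOfD0 fun z => z = z) 0 rfl (by
      intro k n _
      obtain ⟨n', hn', h⟩ := hrI (n + 1) n
      exact ⟨n', ⟨k, n, n', rfl, hn', fun y hy => ((hS _ _).1 hy).symm ▸ h⟩, rfl⟩)
  have hh' : ∀ j, h j < h (j + 1) ∧ SameType C (h j + 1) (r (h j + 1)) (h (j + 1)) := fun j => by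
    obtain ⟨k, n, n', e, h1, h2⟩ := (hh j).2
    obtain ⟨-, e⟩ := pr_inj e
    rw [(pr_inj e).1, (pr_inj e).2]
    exact ⟨h1, h2 _ ((hS _ _).2 rfl)⟩
  have hmono : ∀ i j, i ≤ j → h i ≤ h j := fun i j hij => by
    obtain ⟨d, rfl⟩ := exists_add_of_le hij
    refine (d0_induction (fun d => ∀ y, pr (i + d) y ∈ (S' : Set M.carrier) → h i ≤ y)
      (fun y hy => ?_) (fun d hd y hy => ?_) d) _ ((hS' _ _).2 rfl)
    · rw [add_zero, hS'] at hy
      exact hy.ge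
    · rw [← add_assoc, hS'] at hy
      rw [hy]
      exact (hd _ ((hS' _ _).2 rfl)).trans (hh' _).1.le
  refine ⟨setOfD0 fun z => ∃ j y, z = pr j y ∧ ∃ n, pr j n ∈ (S' : Set M.carrier) ∧
    ∃ w, pr (n + 1) w ∈ (S : Set M.carrier) ∧ pr (pr n w) y ∈ (C : Set M.carrier),
    h, fun j => g (h j), fun z ⟨j, y, hz, _⟩ => ⟨j, y, hz⟩, fun j y => ?_, fun i j hij => ?_⟩
  · rw [mem_setOfD0]
    constructor
    · rintro ⟨j', y', e, n, hn, w, hw, h'⟩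
      obtain ⟨rfl, rfl⟩ := pr_inj e
      obtain rfl := (hS' _ _).1 hn
      obtain rfl := (hS _ _).1 hw
      exact hu _ _ _ _ h' (hg _)
    · rintro rfl
      exact ⟨j, _, rfl, _, (hS' _ _).2 rfl, _, (hS _ _).2 rfl, hg _⟩
  · rcases BasicModel.eq_zero_or_succ j with rfl | ⟨j, rfl⟩
    · exact absurd hij (not_lt_zero' _)
    · have hle := hmono i j (BasicModel.lt_add_one.1 hij)
      have hlt : h i < h j + 1 := BasicModel.lt_add_one.2 hle
      rw [← (hh' j).2 _ hlt, ← hrr (h i + 1) (h j + 1) (by gcongr) _ (lt_add_one _)]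
      exact hg _

/-! ## Finite powersets of well-quasi-orders -/

/-- `x` is an element of `F m` that lies below no element of `F n`. -/
def Witness (F R : M.sets) (m n x : M.carrier) : Prop :=
  ∃ c d, pr m c ∈ (F : Set M.carrier) ∧ pr n d ∈ (F : Set M.carrier) ∧ MemC x c ∧
    ∀ y, MemC y d → ¬ pr x y ∈ (R : Set M.carrier)

instance (F R : M.sets) {n : ℕ} {f g h : (Fin n → M.carrier) → M.carrier} [TermFn f] [TermFn g]
    [TermFn h] : D0 fun v => Witness F R (f v) (g v) (h v) :=
  D0.comp₃ (by unfold Witness; infer_instance) f g h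

theorem satisfies_flatWQO_of_aca : M.Satisfies flatWQO := by
  rw [satisfies_flatWQO]
  intro Q hQ R hR hW
  lift Q to M.sets using hQ
  lift R to M.sets using hR
  let P : M.sets := setOfD0 fun c => IsCode c ∧ ∀ i, MemC i c → i ∈ (Q : Set M.carrier)
  let L : M.sets := setOfD0 fun z => ∃ c d, z = pr c d ∧ c ∈ (P : Set M.carrier) ∧
    d ∈ (P : Set M.carrier) ∧ ∀ x, MemC x c → ∃ y, MemC y d ∧ pr x y ∈ (R : Set M.carrier)
  have hP : IsPow (P : Set M.carrier) (Q : Set M.carrier) := fun c => Iff.rfl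
  have hL : IsFlat (L : Set M.carrier) (P : Set M.carrier) (R : Set M.carrier) := fun z => Iff.rfl
  have hL' : ∀ c d, pr c d ∈ (L : Set M.carrier) ↔ c ∈ (P : Set M.carrier) ∧
      d ∈ (P : Set M.carrier) ∧
        ∀ x, MemC x c → ∃ y, MemC y d ∧ pr x y ∈ (R : Set M.carrier) := fun c d => by
    rw [hL]
    constructor
    · rintro ⟨c', d', e, h⟩
      obtain ⟨rfl, rfl⟩ := pr_inj e
      exact h
    · exact fun h => ⟨c, d, rfl, h⟩
  refine ⟨_, P.2, _, L.2, hP, hL, ⟨?_, ?_, ?_⟩, ?_⟩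
  · rintro z ⟨c, d, h, hc, hd, -⟩
    exact ⟨c, d, h, hc, hd⟩
  · exact fun c hc => (hL' _ _).2 ⟨hc, hc, fun x hx => ⟨x, hx, hW.1.2.1 x (((hP c).1 hc).2 x hx)⟩⟩
  · rintro c d e ⟨h, h'⟩
    rw [hL'] at h h' ⊢
    refine ⟨h.1, h'.2.1, fun x hx => ?_⟩
    obtain ⟨y, hy, hxy⟩ := h.2.2 x hx
    obtain ⟨z, hz, hyz⟩ := h'.2.2 y hy
    exact ⟨z, hz, hW.1.2.2 _ _ _ ⟨hxy, hyz⟩⟩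
  · intro F hF hFs
    lift F to M.sets using hF
    by_contra! hbad
    choose f hf using hFs.2.1
    have hfu : ∀ n c, pr n c ∈ (F : Set M.carrier) → c = f n := fun n c h => hFs.2.2 _ _ _ ⟨h, hf n⟩
    have hfP : ∀ n, f n ∈ (P : Set M.carrier) := fun n => by
      obtain ⟨n', c, e, hc⟩ := hFs.1 _ (hf n)
      rw [(pr_inj e).2]
      exact hc
    have hwit : ∀ m n x, Witness F R m n x ↔ MemC x (f m) ∧
        ∀ y, MemC y (f n) → pr x y ∉ (R : Set M.carrier) := fun m n x => by
      constructor
      · rintro ⟨c, d, hc, hd, h⟩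
        obtain rfl := hfu _ _ hc
        obtain rfl := hfu _ _ hd
        exact h
      · exact fun h => ⟨_, _, hf m, hf n, h⟩
    -- The colour of `(m, n)` is the least witness that `f m ≤^♭ f n` fails.
    let C : M.sets := setOfD0 fun z => ∃ m n x, z = pr (pr m n) x ∧ Witness F R m n x ∧
      ∀ x' < x, ¬ Witness F R m n x'
    have hC : ∀ m n x, pr (pr m n) x ∈ (C : Set M.carrier) ↔ Witness F R m n x ∧
        ∀ x' < x, ¬ Witness F R m n x' := fun m n x => by
      simp only [C, mem_setOfD0]
      constructor
      · rintro ⟨m', n', x', e, h⟩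
        rw [pr_inj_iff, pr_inj_iff] at e
        obtain ⟨⟨rfl, rfl⟩, rfl⟩ := e
        exact h
      · exact fun h => ⟨m, n, x, rfl, h⟩
    obtain ⟨S, h, x, hS, hSx, hx⟩ := exists_endHomogeneous (C := C) (fun m n hmn => by
        obtain ⟨x, hx⟩ := exists_least (fun x => Witness F R m n x) (by
          by_contra! hn
          refine hbad m n _ _ hmn (hf m) (hf n) ((hL' _ _).2 ⟨hfP m, hfP n, fun x hx => ?_⟩)
          by_contra! hy
          exact hn x ((hwit _ _ _).2 ⟨hx, hy⟩))
        exact ⟨x, (hC _ _ _).2 hx⟩)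
      (fun m n x y hx hy => by
        rw [hC] at hx hy
        rcases lt_trichotomy x y with h | h | h
        · exact absurd hx.1 (hy.2 x h)
        · exact h
        · exact absurd hy.1 (hx.2 y h))
      -- Colours for `m` are members of `f m`, hence smaller than this code.
      (fun m => ⟨f m, fun n x hx => ((hwit _ _ _).1 ((hC _ _ _).1 hx).1).1.lt⟩)
    have hx' : ∀ i j, i < j → MemC (x i) (f (h i)) ∧
        ∀ y, MemC y (f (h j)) → pr (x i) y ∉ (R : Set M.carrier) := fun i j hij =>
      (hwit _ _ _).1 ((hC _ _ _).1 (hx i j hij)).1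
    have hmem : ∀ i, MemC (x i) (f (h i)) := fun i => (hx' i _ (lt_add_one i)).1
    -- The wqo `Q` yields `i < j` with `x i` below `x j`. But `x j` belongs to `f (h j)`, no element
    -- of which lies above `x i`.
    obtain ⟨i, j, a, b, hij, ha, hb, hab⟩ := hW.2 S S.2 ⟨fun z hz => by
        obtain ⟨j, y, rfl⟩ := hS z hz
        refine ⟨j, y, rfl, ?_⟩
        rw [(hSx j y).1 hz]
        exact ((hP _).1 (hfP _)).2 _ (hmem j), fun j => ⟨x j, (hSx _ _).2 rfl⟩,
        fun j y z ⟨hy, hz⟩ => ((hSx _ _).1 hy).trans ((hSx _ _).1 hz).symm⟩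
    obtain rfl := (hSx _ _).1 ha
    obtain rfl := (hSx _ _).1 hb
    exact (hx' i j hij).2 _ (hmem j) hab

end Forward
end SOA

open SOA in
/-- Over `RCA₀`, the theory `ACA₀` is equivalent to the statement that the finite powerset of a
wqo, quasi-ordered by `≤^♭`, is a wqo. -/
theorem theorem2p4 : SOA.EquivalentOver.{u} SOA.RCA₀ SOA.ACA₀ SOA.flatWQO := by
  refine ⟨fun M hM => ?_, fun ψ hψ M hM => ?_⟩
  · have := acaModel_of_satisfies M hM
    exact satisfies_flatWQO_of_aca
  · have h := rcaModel_of_satisfies M fun ψ hψ => hM ψ (.inl hψ)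
    have : ACAModel M :=
      { h with sigma' := sigma_mem_sets_of_flatWQO (hM _ (.inr rfl)) }
    exact satisfies_aca ψ hψ
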